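/- Let $k$ be a field. For a connected $\mathbb{N}$-graded $k$-algebra $R$, let $E(R)=\bigoplus_{i,j}E^{i,j}(R)$, $E^{i,j}(R)=\operatorname{Ext}_R^{i,j}(k,k)$, be its bigraded Yoneda algebra, where $i$ is the cohomological degree and $j$ the internal degree inherited from the grading of $R$. For an integer $d>2$ put $\delta_d(2m)=dm$ and $\delta_d(2m+1)=dm+1$. Call $R$ \emph{$2$-$d$-determined} if $R\cong \mathbb{T}(V)/I$ as graded algebras, where $V$ is a finite-dimensional vector space placed in degree $1$ and the two-sided ideal $I$ can be generated by elements of $\mathbb{T}(V)_2$ and $\mathbb{T}(V)_d$, and if $E^{i,j}(R)=0$ unless $j\le\delta_d(i)$. Let $$A=\frac{k\langle a,b,c,d,e,f,l,m\rangle}{\langle bc-ef,\ ae,\ da-lm,\ cl\rangle},\qquad B=\frac{k\langle z\rangle}{\langle z^4\rangle},$$ graded with all generators in degree $1$, and let $C=A\sqcup B$ be their free product (the coproduct in the category of $k$-algebras), with the induced grading. Then $C$ is $2$-$4$-determined, but its Yoneda algebra $E(C)$ is not finitely generated as a $k$-algebra. -/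

import Mathlib

open scoped DirectSum

universe u v w

set_option linter.unusedSectionVars false

/-! ### The cobar complex and the bigraded Yoneda algebra

Let `R` be a connected `ℕ`-graded algebra over a field `k`, with augmentation ideal `R₊`.
The bar resolution `R ⊗ R₊^{⊗ •}` of the trivial module `k` is a resolution by graded free
modules. Applying the graded functor `Hom_R(-, k)` to it gives the cobar complex, whose part of
bidegree `(i, j)` consists of the `k`-multilinear forms in `i` variables from `R₊` that are
supported in total internal degree `j`. Its cohomology is `Ext_R^{i,j}(k, k)`, and the
concatenation product of forms induces the Yoneda product. -/

namespace Yoneda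

/-- Functions on finite words in `N`, with values in `k`. A family of `i`-ary functions
`N × ⋯ × N → k`, one for each `i`, is the same as such a function. -/
def WordFun (k : Type u) (N : Type v) : Type (max u v) := List N → k

namespace WordFun

variable {k : Type u} {N : Type v} [CommRing k]

instance : AddCommGroup (WordFun k N) := inferInstanceAs (AddCommGroup (List N → k))

instance : Module k (WordFun k N) := inferInstanceAs (Module k (List N → k))

/-- Partial evaluation `f(x, -)` at the first letter. -/
def tail (f : WordFun k N) (x : N) : WordFun k N := fun w => f (x :: w)

/-- The concatenation product: `(f * g)(w)` is the sum of `f(u) g(v)` over all ways to write the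
word `w` as `uv`. For an `i`-ary `f` and a `j`-ary `g` this is
`f(x₁, …, xᵢ) g(xᵢ₊₁, …, xᵢ₊ⱼ)`. -/
def conv (f g : WordFun k N) : List N → k
  | [] => f [] * g []
  | x :: w => f [] * g (x :: w) + conv (f.tail x) g w

/-- The cobar differential
`(d f)(x₀, …, xₙ) = ∑ₛ (-1)ˢ f(x₀, …, xₛ xₛ₊₁, …, xₙ)`, the sum over `0 ≤ s < n`. -/
def diff [Mul N] (f : WordFun k N) : List N → k
  | [] => 0
  | [_] => 0
  | x :: y :: w => f ((x * y) :: w) - diff (f.tail x) (y :: w)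

instance : Mul (WordFun k N) := ⟨fun f g => conv f g⟩

instance : One (WordFun k N) := ⟨fun w => match w with | [] => 1 | _ :: _ => 0⟩

theorem ext' {f g : WordFun k N} (h : ∀ w, f w = g w) : f = g := funext h

theorem add_ap (f g : WordFun k N) (w : List N) : (f + g) w = f w + g w := rfl
theorem sub_ap (f g : WordFun k N) (w : List N) : (f - g) w = f w - g w := rfl
theorem neg_ap (f : WordFun k N) (w : List N) : (-f) w = -f w := rfl
theorem smul_ap (c : k) (f : WordFun k N) (w : List N) : (c • f) w = c * f w := rfl
theorem zero_ap (w : List N) : (0 : WordFun k N) w = 0 := rfl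
theorem one_nil : (1 : WordFun k N) [] = 1 := rfl
theorem one_cons (x : N) (w : List N) : (1 : WordFun k N) (x :: w) = 0 := rfl
theorem tail_ap (f : WordFun k N) (x : N) (w : List N) : f.tail x w = f (x :: w) := rfl
theorem mul_nil (f g : WordFun k N) : (f * g) [] = f [] * g [] := rfl
theorem mul_cons (f g : WordFun k N) (x : N) (w : List N) :
    (f * g) (x :: w) = f [] * g (x :: w) + (f.tail x * g) w := rfl

theorem tail_add (f g : WordFun k N) (x : N) : (f + g).tail x = f.tail x + g.tail x := rfl
theorem tail_sub (f g : WordFun k N) (x : N) : (f - g).tail x = f.tail x - g.tail x := rfl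
theorem tail_smul (c : k) (f : WordFun k N) (x : N) : (c • f).tail x = c • f.tail x := rfl
theorem tail_zero (x : N) : (0 : WordFun k N).tail x = 0 := rfl
theorem tail_one (x : N) : (1 : WordFun k N).tail x = 0 := rfl
theorem tail_mul (f g : WordFun k N) (x : N) :
    (f * g).tail x = f [] • g.tail x + f.tail x * g := rfl

theorem add_mul_aux (w : List N) : ∀ f g h : WordFun k N,
    ((f + g) * h) w = (f * h) w + (g * h) w := by
  induction w with
  | nil => intro f g h; simp only [mul_nil, add_ap]; ring
  | cons x w ih => intro f g h; simp only [mul_cons, add_ap, tail_add, ih]; ring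

theorem mul_add_aux (w : List N) : ∀ f g h : WordFun k N,
    (f * (g + h)) w = (f * g) w + (f * h) w := by
  induction w with
  | nil => intro f g h; simp only [mul_nil, add_ap]; ring
  | cons x w ih => intro f g h; simp only [mul_cons, add_ap, ih]; ring

theorem smul_mul_aux (c : k) (w : List N) : ∀ f g : WordFun k N,
    ((c • f) * g) w = c * (f * g) w := by
  induction w with
  | nil => intro f g; simp only [mul_nil, smul_ap]; ring
  | cons x w ih => intro f g; simp only [mul_cons, smul_ap, tail_smul, ih]; ring

theorem mul_smul_aux (c : k) (w : List N) : ∀ f g : WordFun k N,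
    (f * (c • g)) w = c * (f * g) w := by
  induction w with
  | nil => intro f g; simp only [mul_nil, smul_ap]; ring
  | cons x w ih => intro f g; simp only [mul_cons, smul_ap, ih]; ring

theorem zero_mul_aux (w : List N) : ∀ f : WordFun k N, ((0 : WordFun k N) * f) w = 0 := by
  induction w with
  | nil => intro f; simp only [mul_nil, zero_ap, zero_mul]
  | cons x w ih => intro f; simp only [mul_cons, zero_ap, tail_zero, ih, zero_mul, add_zero]

theorem mul_zero_aux (w : List N) : ∀ f : WordFun k N, (f * (0 : WordFun k N)) w = 0 := by
  induction w with
  | nil => intro f; simp only [mul_nil, zero_ap, mul_zero]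
  | cons x w ih => intro f; simp only [mul_cons, zero_ap, ih, mul_zero, add_zero]

theorem one_mul_aux (w : List N) (f : WordFun k N) : ((1 : WordFun k N) * f) w = f w := by
  cases w with
  | nil => simp only [mul_nil, one_nil, one_mul]
  | cons x w => simp only [mul_cons, one_nil, tail_one, zero_mul_aux, one_mul, add_zero]

theorem mul_one_aux (w : List N) : ∀ f : WordFun k N, (f * (1 : WordFun k N)) w = f w := by
  induction w with
  | nil => intro f; simp only [mul_nil, one_nil, mul_one]
  | cons x w ih => intro f; simp only [mul_cons, one_cons, ih, mul_zero, zero_add, tail_ap]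

theorem mul_assoc_aux (w : List N) : ∀ f g h : WordFun k N,
    ((f * g) * h) w = (f * (g * h)) w := by
  induction w with
  | nil => intro f g h; simp only [mul_nil]; ring
  | cons x w ih =>
    intro f g h
    simp only [mul_cons, mul_nil, tail_mul, add_mul_aux, smul_mul_aux, ih]; ring

instance : Ring (WordFun k N) :=
  { (inferInstance : AddCommGroup (WordFun k N)),
    (inferInstance : Mul (WordFun k N)),
    (inferInstance : One (WordFun k N)) with
    left_distrib := fun f g h => ext' fun w => mul_add_aux w f g h
    right_distrib := fun f g h => ext' fun w => add_mul_aux w f g h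
    zero_mul := fun f => ext' fun w => zero_mul_aux w f
    mul_zero := fun f => ext' fun w => mul_zero_aux w f
    mul_assoc := fun f g h => ext' fun w => mul_assoc_aux w f g h
    one_mul := fun f => ext' fun w => one_mul_aux w f
    mul_one := fun f => ext' fun w => mul_one_aux w f }

instance : Algebra k (WordFun k N) :=
  Algebra.ofModule (fun c f g => ext' fun w => smul_mul_aux c w f g)
    (fun c f g => ext' fun w => mul_smul_aux c w f g)

theorem mul_eq_zero_of_splits (w : List N) : ∀ f g : WordFun k N,
    (∀ a b, a ++ b = w → f a = 0 ∨ g b = 0) → (f * g) w = 0 := by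
  induction w with
  | nil =>
    intro f g h
    rcases h [] [] rfl with h | h <;> simp [mul_nil, h]
  | cons x w ih =>
    intro f g h
    have h1 : f [] * g (x :: w) = 0 := by
      rcases h [] (x :: w) rfl with h | h <;> simp [h]
    have h2 : (f.tail x * g) w = 0 := ih _ _ fun a b hab => h (x :: a) b (by simp [hab])
    rw [mul_cons, h1, h2, add_zero]

section Diff

theorem diff_add_aux [Mul N] (w : List N) : ∀ f g : WordFun k N,
    diff (f + g) w = diff f w + diff g w := by
  induction w with
  | nil => intro f g; simp [diff]
  | cons x w ih =>
    intro f g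
    cases w with
    | nil => simp [diff]
    | cons y w => simp only [diff, tail_add, ih, add_ap]; ring

theorem diff_smul_aux [Mul N] (c : k) (w : List N) : ∀ f : WordFun k N,
    diff (c • f) w = c * diff f w := by
  induction w with
  | nil => intro f; simp [diff]
  | cons x w ih =>
    intro f
    cases w with
    | nil => simp [diff]
    | cons y w => simp only [diff, tail_smul, ih, smul_ap]; ring

/-- The cobar differential as a linear map. -/
def d [Mul N] : WordFun k N →ₗ[k] WordFun k N where
  toFun f := diff f
  map_add' f g := ext' fun w => diff_add_aux w f g
  map_smul' c f := ext' fun w => diff_smul_aux c w f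

theorem d_nil [Mul N] (f : WordFun k N) : d f [] = 0 := rfl
theorem d_single [Mul N] (f : WordFun k N) (x : N) : d f [x] = 0 := rfl
theorem d_cons [Mul N] (f : WordFun k N) (x y : N) (w : List N) :
    d f (x :: y :: w) = f ((x * y) :: w) - d (f.tail x) (y :: w) := rfl

theorem d_eq_zero_of_merges [Mul N] (w : List N) : ∀ f : WordFun k N,
    (∀ a x y b, w = a ++ x :: y :: b → f (a ++ (x * y) :: b) = 0) → d f w = 0 := by
  induction w with
  | nil => intro f _; rfl
  | cons x w ih =>
    intro f h
    cases w with
    | nil => rfl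
    | cons y w =>
      have h1 := h [] x y w rfl
      have h2 := ih (f.tail x) fun a x' y' b hw => h (x :: a) x' y' b (by simp [hw])
      rw [d_cons, h2, sub_zero]
      simpa using h1

theorem d_one [Mul N] : d (1 : WordFun k N) = 0 :=
  ext' fun w => d_eq_zero_of_merges w _ fun a x y b _ => by cases a <;> rfl

/-- The sign operator: multiplication by `(-1)ⁱ` on `i`-ary functions. -/
def sgn (f : WordFun k N) : WordFun k N := fun w => (-1) ^ w.length * f w

theorem sgn_nil (f : WordFun k N) : sgn f [] = f [] := by simp [sgn]
theorem tail_sgn (f : WordFun k N) (x : N) : (sgn f).tail x = -sgn (f.tail x) :=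
  ext' fun w => by simp only [tail_ap, sgn, List.length_cons, pow_succ, neg_ap]; ring
theorem sgn_sgn (f : WordFun k N) : sgn (sgn f) = f :=
  ext' fun w => by
    simp only [sgn]; rw [← mul_assoc, ← mul_pow]; simp

theorem d_sgn_aux [Mul N] (w : List N) : ∀ f : WordFun k N,
    d (sgn f) w = -sgn (d f) w := by
  induction w with
  | nil => intro f; simp [d_nil, sgn]
  | cons x w ih =>
    intro f
    cases w with
    | nil => simp [d_single, sgn]
    | cons y w =>
      rw [d_cons, tail_sgn, map_neg, neg_ap, ih]
      simp only [sgn, d_cons, List.length_cons, pow_succ]; ring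

theorem d_sgn [Mul N] (f : WordFun k N) : d (sgn f) = -sgn (d f) :=
  ext' fun w => d_sgn_aux w f

/-- The function `f(x y, …)` of `(y, …)`. -/
def mulHead [Mul N] (f : WordFun k N) (x : N) : WordFun k N
  | [] => 0
  | y :: w => f ((x * y) :: w)

theorem tail_d [Mul N] (f : WordFun k N) (x : N) :
    (d f).tail x = mulHead f x - d (f.tail x) :=
  ext' fun w => by
    cases w with
    | nil => simp [tail_ap, d_single, sub_ap, mulHead, d_nil]
    | cons y w => rfl

theorem d_mul_aux [Mul N] (w : List N) : ∀ f g : WordFun k N,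
    d (f * g) w = (d f * g) w + (sgn f * d g) w := by
  induction w with
  | nil => intro f g; simp [d_nil, mul_nil]
  | cons x w ih =>
    intro f g
    cases w with
    | nil =>
      simp only [d_single, mul_cons, mul_nil, d_nil, tail_ap]; simp
    | cons y w =>
      have e1 : ((d f).tail x * g) (y :: w) =
          ((f.tail (x * y)) * g) w - (d (f.tail x) * g) (y :: w) := by
        rw [tail_d, sub_mul, sub_ap]
        have : (mulHead f x).tail y = f.tail (x * y) := rfl
        rw [mul_cons (mulHead f x), this]
        simp [mulHead]
      rw [d_cons, tail_mul, map_add, map_smul, add_ap, smul_ap, ih, mul_cons f,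
        mul_cons (d f), mul_cons (sgn f), e1, d_nil, sgn_nil, d_cons g, tail_sgn, neg_mul, neg_ap]
      ring

theorem d_mul [Mul N] (f g : WordFun k N) : d (f * g) = d f * g + sgn f * d g :=
  ext' fun w => d_mul_aux w f g

theorem d_d_aux [Semigroup N] (w : List N) : ∀ f : WordFun k N, d (d f) w = 0 := by
  induction w with
  | nil => intro f; rfl
  | cons x w ih =>
    intro f
    cases w with
    | nil => rfl
    | cons y w =>
      rw [d_cons, tail_d, map_sub, sub_ap, ih, sub_zero]
      cases w with
      | nil => simp [d_single]
      | cons z w =>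
        have : (mulHead f x).tail y = f.tail (x * y) := rfl
        rw [d_cons, d_cons, this]
        simp [mulHead, mul_assoc]

theorem d_d [Semigroup N] (f : WordFun k N) : d (d f) = 0 := ext' fun w => d_d_aux w f

end Diff

section Multilinear

variable [NonUnitalRing N] [Module k N]

/-- `f` is `k`-linear in each letter. -/
def IsMultilinear (f : WordFun k N) : Prop :=
  ∀ a b : List N, IsLinearMap k fun x : N => f (a ++ x :: b)

theorem isMultilinear_iff {f : WordFun k N} : IsMultilinear f ↔
    ∀ (a b : List N) (c : k) (x y : N),
      f (a ++ (c • x + y) :: b) = c * f (a ++ x :: b) + f (a ++ y :: b) := by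
  constructor
  · intro h a b c x y
    have := h a b
    rw [this.map_add, this.map_smul, smul_eq_mul]
  · intro h a b
    have hz : f (a ++ (0 : N) :: b) = 0 := by
      have := h a b 1 0 0
      simpa using this
    refine ⟨fun x y => ?_, fun c x => ?_⟩
    · simpa using h a b 1 x y
    · simpa [hz] using h a b c x 0

theorem IsMultilinear.tail {f : WordFun k N} (hf : IsMultilinear f) (x : N) :
    IsMultilinear (f.tail x) := fun a b => hf (x :: a) b

theorem IsMultilinear.tail_lin {f : WordFun k N} (hf : IsMultilinear f) (c : k) (x y : N) :
    f.tail (c • x + y) = c • f.tail x + f.tail y :=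
  ext' fun w => isMultilinear_iff.1 hf [] w c x y

theorem IsMultilinear.mul {f g : WordFun k N} (hf : IsMultilinear f) (hg : IsMultilinear g) :
    IsMultilinear (f * g) := by
  rw [isMultilinear_iff]
  intro a
  induction a generalizing f with
  | nil =>
    intro b c x y
    have := isMultilinear_iff.1 hg [] b c x y
    simp only [List.nil_append] at this ⊢
    rw [mul_cons, mul_cons, mul_cons, this, hf.tail_lin, add_mul, add_ap, smul_mul_aux]
    ring
  | cons z a ih =>
    intro b c x y
    have := isMultilinear_iff.1 hg (z :: a) b c x y
    simp only [List.cons_append] at this ⊢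
    rw [mul_cons, mul_cons, mul_cons, this, ih (hf.tail z)]
    ring

theorem IsMultilinear.d [IsScalarTower k N N] [SMulCommClass k N N]
    {f : WordFun k N} (hf : IsMultilinear f) : IsMultilinear (d f) := by
  rw [isMultilinear_iff]
  intro a
  induction a generalizing f with
  | nil =>
    intro b c x y
    cases b with
    | nil => simp [d_single]
    | cons z b =>
      have := isMultilinear_iff.1 hf [] b c (x * z) (y * z)
      simp only [List.nil_append] at this ⊢
      rw [d_cons, d_cons, d_cons, add_mul, smul_mul_assoc, this, hf.tail_lin, map_add, map_smul,
        add_ap, smul_ap]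
      ring
  | cons z a ih =>
    intro b c x y
    have key := ih (hf.tail z) b c x y
    cases a with
    | nil =>
      have := isMultilinear_iff.1 hf [] b c (z * x) (z * y)
      simp only [List.nil_append, List.cons_append] at this key ⊢
      rw [d_cons, d_cons, d_cons, mul_add, mul_smul_comm, this, key]
      ring
    | cons t a =>
      have := isMultilinear_iff.1 hf ((z * t) :: a) b c x y
      simp only [List.cons_append] at this key ⊢
      rw [d_cons, d_cons, d_cons, this, key]
      ring

theorem IsMultilinear.one : IsMultilinear (1 : WordFun k N) :=
  isMultilinear_iff.2 fun a b c x y => by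
    have h : ∀ (a b : List N) (x : N), (1 : WordFun k N) (a ++ x :: b) = 0 := fun a b x => by
      cases a <;> rfl
    rw [h, h, h, mul_zero, add_zero]

end Multilinear

end WordFun

open WordFun

section Graded

variable {k : Type u} [Field k] {R : Type v} [Ring R] [Algebra k R]
  (𝒜 : ℕ → Submodule k R) [GradedAlgebra 𝒜]

/-- The augmentation ideal `R₊ = ⨁_{n > 0} R_n`, as a non-unital algebra. -/
def augIdeal : NonUnitalSubalgebra k R where
  carrier := {x | GradedRing.projZeroRingHom 𝒜 x = 0}
  add_mem' {x y} hx hy := by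
    simp only [Set.mem_ofPred_eq] at hx hy ⊢
    rw [map_add, hx, hy, add_zero]
  zero_mem' := map_zero _
  mul_mem' {x y} hx hy := by
    simp only [Set.mem_ofPred_eq] at hx hy ⊢
    rw [map_mul, hx, zero_mul]
  smul_mem' c x hx := by
    simp only [Set.mem_ofPred_eq] at hx ⊢
    rw [Algebra.smul_def, map_mul, hx, mul_zero]

/-- The cobar cochains of bidegree `p = (i, j)`: the multilinear forms in `i` variables from `R₊`
that vanish on all tuples of homogeneous elements whose degrees do not add up to `j`. -/
def cobar (p : ℕ × ℕ) : Submodule k (WordFun k (augIdeal 𝒜)) where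
  carrier := {f | IsMultilinear f ∧ (∀ w, w.length ≠ p.1 → f w = 0) ∧
    ∀ w ds, List.Forall₂ (fun (x : augIdeal 𝒜) (n : ℕ) => (x : R) ∈ 𝒜 n) w ds →
      ds.sum ≠ p.2 → f w = 0}
  add_mem' {f g} hf hg := by
    refine ⟨isMultilinear_iff.2 fun a b c x y => ?_, fun w h => ?_, fun w ds h h' => ?_⟩
    · rw [add_ap, add_ap, add_ap, isMultilinear_iff.1 hf.1, isMultilinear_iff.1 hg.1]; ring
    · rw [add_ap, hf.2.1 w h, hg.2.1 w h, add_zero]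
    · rw [add_ap, hf.2.2 w ds h h', hg.2.2 w ds h h', add_zero]
  zero_mem' := ⟨isMultilinear_iff.2 fun a b c x y => by simp [zero_ap], fun _ _ => rfl,
    fun _ _ _ _ => rfl⟩
  smul_mem' c f hf := by
    refine ⟨isMultilinear_iff.2 fun a b c x y => ?_, fun w h => ?_, fun w ds h h' => ?_⟩
    · rw [smul_ap, smul_ap, smul_ap, isMultilinear_iff.1 hf.1]; ring
    · rw [smul_ap, hf.2.1 w h, mul_zero]
    · rw [smul_ap, hf.2.2 w ds h h', mul_zero]

theorem one_mem_cobar : (1 : WordFun k (augIdeal 𝒜)) ∈ cobar 𝒜 0 := by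
  refine ⟨IsMultilinear.one, fun w h => ?_, fun w ds h h' => ?_⟩
  · cases w with
    | nil => exact absurd rfl h
    | cons x w => rfl
  · cases h with
    | nil => exact absurd rfl h'
    | cons _ _ => rfl

theorem forall₂_append_split {α β : Type*} {r : α → β → Prop} {a b : List α} {ds : List β}
    (h : List.Forall₂ r (a ++ b) ds) :
    ∃ d₁ d₂, ds = d₁ ++ d₂ ∧ List.Forall₂ r a d₁ ∧ List.Forall₂ r b d₂ := by
  induction a generalizing ds with
  | nil => exact ⟨[], ds, rfl, List.Forall₂.nil, h⟩
  | cons x a ih =>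
    cases h with
    | cons hx h =>
      obtain ⟨d₁, d₂, rfl, h₁, h₂⟩ := ih h
      exact ⟨_ :: d₁, d₂, rfl, List.Forall₂.cons hx h₁, h₂⟩

theorem forall₂_append_join {α β : Type*} {r : α → β → Prop} {a b : List α} {d₁ d₂ : List β}
    (h₁ : List.Forall₂ r a d₁) (h₂ : List.Forall₂ r b d₂) :
    List.Forall₂ r (a ++ b) (d₁ ++ d₂) := by
  induction h₁ with
  | nil => exact h₂
  | cons hx _ ih => exact List.Forall₂.cons hx ih

theorem mul_mem_cobar {p q : ℕ × ℕ} {f g : WordFun k (augIdeal 𝒜)}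
    (hf : f ∈ cobar 𝒜 p) (hg : g ∈ cobar 𝒜 q) : f * g ∈ cobar 𝒜 (p + q) := by
  refine ⟨hf.1.mul hg.1, fun w h => ?_, fun w ds h h' => ?_⟩
  · refine mul_eq_zero_of_splits w f g fun a b hab => ?_
    by_cases ha : a.length = p.1
    · refine Or.inr (hg.2.1 b fun hb => h ?_)
      rw [← hab, List.length_append, ha, hb]; rfl
    · exact Or.inl (hf.2.1 a ha)
  · refine mul_eq_zero_of_splits w f g fun a b hab => ?_
    subst hab
    obtain ⟨d₁, d₂, rfl, h₁, h₂⟩ := forall₂_append_split h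
    by_cases ha : d₁.sum = p.2
    · refine Or.inr (hg.2.2 b d₂ h₂ fun hb => h' ?_)
      rw [List.sum_append, ha, hb]; rfl
    · exact Or.inl (hf.2.2 a d₁ h₁ ha)

theorem d_mem_cobar {i j : ℕ} {f : WordFun k (augIdeal 𝒜)}
    (hf : f ∈ cobar 𝒜 (i, j)) : d f ∈ cobar 𝒜 (i + 1, j) := by
  refine ⟨hf.1.d, fun w h => ?_, fun w ds h h' => ?_⟩
  · refine d_eq_zero_of_merges w f fun a x y b hw => hf.2.1 _ fun hl => h ?_
    subst hw
    simp only [List.length_append, List.length_cons] at hl ⊢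
    omega
  · refine d_eq_zero_of_merges w f fun a x y b hw => ?_
    subst hw
    obtain ⟨d₁, d₂, rfl, h₁, h₂⟩ := forall₂_append_split h
    cases h₂ with
    | cons hx h₂ =>
      cases h₂ with
      | @cons _ m _ d₂ hy h₂ =>
        rename_i n
        refine hf.2.2 _ (d₁ ++ (n + m) :: d₂)
          (forall₂_append_join h₁ (List.Forall₂.cons ?_ h₂)) fun hs => h' ?_
        · exact SetLike.mul_mem_graded hx hy
        · simp only [List.sum_append, List.sum_cons] at hs ⊢
          omega

theorem sgn_mem_cobar {p : ℕ × ℕ} {f : WordFun k (augIdeal 𝒜)}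
    (hf : f ∈ cobar 𝒜 p) : sgn f ∈ cobar 𝒜 p := by
  have : sgn f = ((-1 : k) ^ p.1) • f := ext' fun w => by
    rw [smul_ap, sgn]
    by_cases h : w.length = p.1
    · rw [h]
    · rw [hf.2.1 w h, mul_zero, mul_zero]
  rw [this]
  exact Submodule.smul_mem _ _ hf

instance : SetLike.GradedMonoid (cobar 𝒜) where
  one_mem := one_mem_cobar 𝒜
  mul_mem _ _ _ _ hf hg := mul_mem_cobar 𝒜 hf hg

/-- The cobar algebra: the finite sums of cochains homogeneous for the bigrading. -/
noncomputable def cobarAlg : Subalgebra k (WordFun k (augIdeal 𝒜)) :=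
  (DirectSum.coeAlgHom (cobar 𝒜)).range

theorem cobarAlg_induction {P : WordFun k (augIdeal 𝒜) → Prop} (h0 : P 0)
    (hh : ∀ p, ∀ f ∈ cobar 𝒜 p, P f) (hadd : ∀ f g, P f → P g → P (f + g))
    {f : WordFun k (augIdeal 𝒜)} (hf : f ∈ cobarAlg 𝒜) : P f := by
  obtain ⟨F, rfl⟩ := hf
  induction F using DirectSum.induction_on with
  | zero => simpa using h0
  | of p x => simpa using hh p _ x.2
  | add F G hF hG => simpa using hadd _ _ hF hG

theorem mem_cobarAlg {p : ℕ × ℕ} {f : WordFun k (augIdeal 𝒜)} (hf : f ∈ cobar 𝒜 p) :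
    f ∈ cobarAlg 𝒜 :=
  ⟨DirectSum.of (fun p => cobar 𝒜 p) p ⟨f, hf⟩, DirectSum.coeAlgHom_of _ _ _⟩

theorem sgn_add {N : Type v} (f g : WordFun k N) : sgn (f + g) = sgn f + sgn g :=
  ext' fun w => by simp only [sgn, add_ap]; ring

theorem sgn_mem_cobarAlg {f : WordFun k (augIdeal 𝒜)} (hf : f ∈ cobarAlg 𝒜) :
    sgn f ∈ cobarAlg 𝒜 := by
  refine cobarAlg_induction 𝒜 (P := fun f => sgn f ∈ cobarAlg 𝒜) ?_ ?_ ?_ hf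
  · have : sgn (0 : WordFun k (augIdeal 𝒜)) = 0 := ext' fun w => by simp [sgn, zero_ap]
    rw [this]; exact zero_mem _
  · exact fun p f hf => mem_cobarAlg 𝒜 (sgn_mem_cobar 𝒜 hf)
  · intro f g hf hg
    rw [sgn_add]; exact add_mem hf hg

theorem d_mem_cobarAlg {f : WordFun k (augIdeal 𝒜)} (hf : f ∈ cobarAlg 𝒜) :
    d f ∈ cobarAlg 𝒜 := by
  refine cobarAlg_induction 𝒜 (P := fun f => d f ∈ cobarAlg 𝒜) ?_ ?_ ?_ hf
  · rw [map_zero]; exact zero_mem _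
  · exact fun p f hf => mem_cobarAlg 𝒜 (d_mem_cobar 𝒜 (i := p.1) (j := p.2) hf)
  · intro f g hf hg
    rw [map_add]; exact add_mem hf hg

/-- The algebra of cocycles of the cobar algebra. -/
noncomputable def cocycles : Subalgebra k (WordFun k (augIdeal 𝒜)) where
  carrier := {f | f ∈ cobarAlg 𝒜 ∧ d f = 0}
  add_mem' {f g} hf hg := ⟨add_mem hf.1 hg.1, by rw [map_add, hf.2, hg.2, add_zero]⟩
  mul_mem' {f g} hf hg := ⟨mul_mem hf.1 hg.1, by
    rw [d_mul, hf.2, hg.2, zero_mul, mul_zero, add_zero]⟩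
  algebraMap_mem' c := ⟨Subalgebra.algebraMap_mem _ c, by
    rw [Algebra.algebraMap_eq_smul_one, map_smul, d_one, smul_zero]⟩

/-- The two-sided ideal of coboundaries in the algebra of cocycles. -/
noncomputable def coboundaries : Ideal (cocycles 𝒜) where
  carrier := {z | ∃ b ∈ cobarAlg 𝒜, d b = z}
  add_mem' := by
    rintro z z' ⟨b, hb, h⟩ ⟨b', hb', h'⟩
    exact ⟨b + b', add_mem hb hb', by rw [map_add, h, h']; rfl⟩
  zero_mem' := ⟨0, zero_mem _, map_zero _⟩
  smul_mem' := by
    rintro c z ⟨b, hb, h⟩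
    refine ⟨sgn (c : WordFun k (augIdeal 𝒜)) * b,
      mul_mem (sgn_mem_cobarAlg 𝒜 c.2.1) hb, ?_⟩
    have hc : sgn (0 : WordFun k (augIdeal 𝒜)) = 0 := ext' fun w => by simp [sgn, zero_ap]
    rw [d_mul, d_sgn, c.2.2, hc, sgn_sgn, h, neg_zero, zero_mul, zero_add]
    rfl

instance : (coboundaries 𝒜).IsTwoSided where
  mul_mem_of_left := by
    rintro z c ⟨b, hb, h⟩
    refine ⟨b * c, mul_mem hb c.2.1, ?_⟩
    rw [d_mul, c.2.2, h, mul_zero, add_zero]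
    rfl

/-- The Yoneda algebra `E(R) = ⨁_{i,j} Ext_R^{i,j}(k, k)` of a connected graded algebra `R`:
the cohomology algebra of the cobar algebra. -/
abbrev ExtAlg : Type (max u v) := cocycles 𝒜 ⧸ coboundaries 𝒜

/-- The component `E^{i,j}(R) = Ext_R^{i,j}(k, k)` of the Yoneda algebra: the classes of the
cocycles of cohomological degree `i` and internal degree `j`. -/
noncomputable def extComp (i j : ℕ) : Submodule k (ExtAlg 𝒜) :=
  ((cobar 𝒜 (i, j)).comap (cocycles 𝒜).val.toLinearMap).map
    (Ideal.Quotient.mkₐ k (coboundaries 𝒜)).toLinearMap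

end Graded

/-! ### `2`-`d`-determined algebras -/

/-- The part of degree `n` of the free algebra on `X`, whose letters have degree one. -/
noncomputable def freePart (k : Type u) [Field k] (X : Type w) (n : ℕ) :
    Submodule k (FreeAlgebra k X) :=
  Submodule.span k (Set.range (FreeAlgebra.ι k)) ^ n

/-- The function `δ` with `δ(2m) = d m` and `δ(2m + 1) = d m + 1`. -/
def delta (d i : ℕ) : ℕ := d * (i / 2) + i % 2

/-- A graded algebra `R` is `2`-`d`-determined (`d > 2`) if it is, as a graded algebra, a quotient
of a free algebra on finitely many letters of degree one by a two-sided ideal that is generated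
by elements of degrees `2` and `d`, and `E^{i,j}(R) = 0` unless `j ≤ δ(i)`. -/
structure IsTwoDetermined {k : Type u} [Field k] {R : Type v} [Ring R] [Algebra k R]
    (𝒜 : ℕ → Submodule k R) [GradedAlgebra 𝒜] (d : ℕ) : Prop where
  two_lt : 2 < d
  presentation : ∃ (r : ℕ) (π : FreeAlgebra k (Fin r) →ₐ[k] R),
    Function.Surjective π ∧ (∀ x, π (FreeAlgebra.ι k x) ∈ 𝒜 1) ∧
    TwoSidedIdeal.ker π = TwoSidedIdeal.span
      {p | π p = 0 ∧ (p ∈ freePart k (Fin r) 2 ∨ p ∈ freePart k (Fin r) d)}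
  bidegrees : ∀ i j, extComp 𝒜 i j ≠ ⊥ → j ≤ delta d i

/-! ### Graded algebras given by generators of degree one and homogeneous relations -/

theorem of_eq_of {k : Type u} [Field k] {S : Type v} [Ring S] [Algebra k S]
    {𝒮 : ℕ → Submodule k S} {i j : ℕ} (h : i = j) {x : 𝒮 i} {y : 𝒮 j} (hxy : (x : S) = y) :
    DirectSum.of (fun n => 𝒮 n) i x = DirectSum.of (fun n => 𝒮 n) j y := by
  subst h
  rw [Subtype.ext hxy]

theorem of_eq_zero {k : Type u} [Field k] {S : Type v} [Ring S] [Algebra k S]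
    {𝒮 : ℕ → Submodule k S} {i : ℕ} {x : 𝒮 i} (hx : (x : S) = 0) :
    DirectSum.of (fun n => 𝒮 n) i x = 0 := by
  rw [show x = 0 from Subtype.ext hx, map_zero]

section Presented

variable {k : Type u} [Field k] {X : Type w}

/-- The algebra `k⟨X⟩ / (rels)`. -/
abbrev Presented (rels : Set (FreeAlgebra k X)) : Type (max u w) :=
  RingQuot fun p q : FreeAlgebra k X => p ∈ rels ∧ q = 0

/-- The quotient map `k⟨X⟩ → k⟨X⟩ / (rels)`. -/
noncomputable def proj (rels : Set (FreeAlgebra k X)) : FreeAlgebra k X →ₐ[k] Presented rels :=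
  RingQuot.mkAlgHom k _

/-- The part of degree `n` of `k⟨X⟩ / (rels)`, spanned by the classes of words of length `n`. -/
noncomputable def presPart (rels : Set (FreeAlgebra k X)) (n : ℕ) : Submodule k (Presented rels) :=
  (freePart k X n).map (proj rels).toLinearMap

instance (rels : Set (FreeAlgebra k X)) : SetLike.GradedMonoid (presPart rels) where
  one_mem := ⟨1, by simp [freePart], map_one (proj rels)⟩
  mul_mem := by
    rintro i j _ _ ⟨p, hp, rfl⟩ ⟨q, hq, rfl⟩
    refine ⟨p * q, ?_, map_mul (proj rels) _ _⟩
    have := Submodule.mul_mem_mul hp hq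
    rwa [freePart, freePart, ← pow_add] at this

/-- The map `k⟨X⟩ → ⨁ₙ (k⟨X⟩ / (rels))ₙ` that sends each letter to its class in degree one. -/
noncomputable def freeDecomp (rels : Set (FreeAlgebra k X)) :
    FreeAlgebra k X →ₐ[k] ⨁ n, presPart rels n :=
  FreeAlgebra.lift k fun x => DirectSum.of (fun n => presPart rels n) 1
    ⟨proj rels (FreeAlgebra.ι k x), FreeAlgebra.ι k x, by
      simpa [freePart] using Submodule.subset_span (Set.mem_range_self x), rfl⟩

theorem freeDecomp_of_mem (rels : Set (FreeAlgebra k X)) {n : ℕ} {p : FreeAlgebra k X}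
    (hp : p ∈ freePart k X n) :
    freeDecomp rels p = DirectSum.of (fun n => presPart rels n) n
      ⟨proj rels p, p, hp, rfl⟩ := by
  unfold freePart at hp
  induction hp using Submodule.pow_induction_on_left' with
  | algebraMap r =>
    rw [AlgHom.commutes, DirectSum.algebraMap_apply]
    exact of_eq_of rfl ((proj rels).commutes r).symm
  | add x y i hx hy ihx ihy =>
    rw [map_add, ihx, ihy, ← map_add]
    congr 1
    ext
    simp
  | mem_mul m hm i x hx ih =>
    rw [map_mul, ih]
    have key : freeDecomp rels m = DirectSum.of (fun n => presPart rels n) 1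
        ⟨proj rels m, m, by simpa [freePart] using hm, rfl⟩ := by
      induction hm using Submodule.span_induction with
      | mem y hy =>
        obtain ⟨y, rfl⟩ := hy
        simp [freeDecomp]
      | zero =>
        rw [map_zero]; symm
        exact of_eq_zero (map_zero (proj rels))
      | add y z _ _ hy hz =>
        rw [map_add, hy, hz, ← map_add]
        congr 1
        ext
        simp
      | smul c y _ hy =>
        rw [map_smul, hy, ← DirectSum.lof_eq_of k, ← DirectSum.lof_eq_of k, ← map_smul]
        congr 1
        ext
        simp
    rw [key, DirectSum.of_mul_of]
    exact of_eq_of (add_comm _ _) (map_mul (proj rels) m x).symm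

/-- If the relations are homogeneous, `k⟨X⟩ / (rels)` is graded by word length. -/
noncomputable abbrev presGraded (rels : Set (FreeAlgebra k X))
    (h : ∀ p ∈ rels, ∃ n, p ∈ freePart k X n) : GradedAlgebra (presPart rels) :=
  have hz : ∀ p ∈ rels, proj rels p = 0 := fun p hp => by
    have := RingQuot.mkAlgHom_rel k
      (s := fun p q : FreeAlgebra k X => p ∈ rels ∧ q = 0) (x := p) (y := 0) ⟨hp, rfl⟩
    rw [map_zero] at this
    exact this
  have hr : ∀ ⦃p q : FreeAlgebra k X⦄, (p ∈ rels ∧ q = 0) →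
      freeDecomp rels p = freeDecomp rels q := by
    rintro p _ ⟨hp, rfl⟩
    obtain ⟨n, hn⟩ := h p hp
    rw [freeDecomp_of_mem rels hn, map_zero]
    exact of_eq_zero (hz p hp)
  have hl : ∀ p, RingQuot.liftAlgHom k ⟨freeDecomp rels, hr⟩ (proj rels p) =
      freeDecomp rels p := fun p => RingQuot.liftAlgHom_mkAlgHom_apply _ _ _ _
  GradedAlgebra.ofAlgHom _ (RingQuot.liftAlgHom k ⟨freeDecomp rels, hr⟩)
    (by
      refine RingQuot.ringQuot_ext' _ _ _ (FreeAlgebra.hom_ext (funext fun x => ?_))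
      have := hl (FreeAlgebra.ι k x)
      simp only [Function.comp_apply, AlgHom.comp_apply, AlgHom.id_apply]
      change DirectSum.coeAlgHom _ (RingQuot.liftAlgHom k _ (proj rels _)) = proj rels _
      rw [this]
      simp [freeDecomp])
    (by
      rintro n ⟨_, p, hp, rfl⟩
      exact (hl p).trans (freeDecomp_of_mem rels hp))

end Presented

/-! ### The grading of a free product of graded algebras -/

section FreeProduct

open LinearAlgebra

variable {k : Type u} [Field k] {I : Type w} [DecidableEq I] {A : I → Type v}
  [∀ i, Ring (A i)] [∀ i, Algebra k (A i)]

/-- The part of degree `n` of the free product of graded algebras: the span of all products of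
homogeneous elements of the factors whose degrees add up to `n`. -/
noncomputable def fpPart (𝒜 : ∀ i, ℕ → Submodule k (A i)) (n : ℕ) :
    Submodule k (FreeProduct k A) :=
  Submodule.span k {x | ∃ w : List (Σ i : I, Σ m : ℕ, 𝒜 i m),
    (w.map fun s => s.2.1).sum = n ∧
    (w.map fun s => FreeProduct.ι k A s.1 (s.2.2 : A s.1)).prod = x}

instance (𝒜 : ∀ i, ℕ → Submodule k (A i)) : SetLike.GradedMonoid (fpPart 𝒜) where
  one_mem := Submodule.subset_span ⟨[], rfl, rfl⟩
  mul_mem := by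
    intro i j x y hx hy
    have := Submodule.mul_mem_mul hx hy
    rw [fpPart, fpPart, Submodule.span_mul_span] at this
    refine Submodule.span_mono ?_ this
    rintro _ ⟨_, ⟨w, rfl, rfl⟩, _, ⟨w', rfl, rfl⟩, rfl⟩
    exact ⟨w ++ w', by simp, by simp⟩

theorem ι_mem_fpPart (𝒜 : ∀ i, ℕ → Submodule k (A i)) {i : I} {n : ℕ} {x : A i}
    (hx : x ∈ 𝒜 i n) : FreeProduct.ι k A i x ∈ fpPart 𝒜 n :=
  Submodule.subset_span ⟨[⟨i, n, x, hx⟩], by simp, by simp⟩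

/-- The inclusion of a homogeneous part of a factor into the free product. -/
noncomputable def fpLin (𝒜 : ∀ i, ℕ → Submodule k (A i)) (i : I) (n : ℕ) :
    𝒜 i n →ₗ[k] ⨁ n, fpPart 𝒜 n where
  toFun x := DirectSum.of (fun n => fpPart 𝒜 n) n
    ⟨FreeProduct.ι k A i (x : A i), ι_mem_fpPart 𝒜 x.2⟩
  map_add' x y := by
    rw [← map_add]
    exact of_eq_of rfl (map_add (FreeProduct.ι k A i) x.1 y.1)
  map_smul' c x := by
    rw [← DirectSum.lof_eq_of k, ← DirectSum.lof_eq_of k, ← map_smul, DirectSum.lof_eq_of,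
      DirectSum.lof_eq_of]
    exact of_eq_of rfl (map_smul (FreeProduct.ι k A i) c x.1)

variable (𝒜 : ∀ i, ℕ → Submodule k (A i)) [∀ i, GradedAlgebra (𝒜 i)]

/-- The graded inclusion of a factor into the free product. -/
noncomputable def fpHom (i : I) : (⨁ n, 𝒜 i n) →ₐ[k] ⨁ n, fpPart 𝒜 n :=
  DirectSum.toAlgebra k (fun n => 𝒜 i n) (fpLin 𝒜 i)
    (of_eq_of rfl (map_one (FreeProduct.ι k A i)))
    (fun {m n} x y => by
      refine Eq.trans ?_ (DirectSum.of_mul_of _ _).symm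
      exact of_eq_of rfl (map_mul (FreeProduct.ι k A i) x.1 y.1))

/-- The inclusion of a factor into the free product, decomposed by degrees. -/
noncomputable def fpIncl (i : I) : A i →ₐ[k] ⨁ n, fpPart 𝒜 n :=
  (fpHom 𝒜 i).comp (DirectSum.decomposeAlgEquiv (𝒜 i) : A i →ₐ[k] ⨁ n, 𝒜 i n)

theorem fpIncl_of_mem {i : I} {n : ℕ} (x : 𝒜 i n) :
    fpIncl 𝒜 i (x : A i) = DirectSum.of (fun n => fpPart 𝒜 n) n
      ⟨FreeProduct.ι k A i x, ι_mem_fpPart 𝒜 x.2⟩ := by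
  change fpHom 𝒜 i (DirectSum.decompose (𝒜 i) (x : A i)) = _
  rw [DirectSum.decompose_coe]
  exact DirectSum.toAddMonoid_of (fun n => (fpLin 𝒜 i n).toAddMonoidHom) n x

/-- The decomposition of the free product into its homogeneous parts. -/
noncomputable def fpDecomp : FreeProduct k A →ₐ[k] ⨁ n, fpPart 𝒜 n :=
  FreeProduct.lift k A fun {i} => fpIncl 𝒜 i

theorem fpDecomp_ι (i : I) (x : A i) :
    fpDecomp 𝒜 (FreeProduct.ι k A i x) = fpIncl 𝒜 i x :=
  DFunLike.congr_fun (FreeProduct.lift_comp_ι (i := i) k A fun {i} => fpIncl 𝒜 i) x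

theorem fpDecomp_word (w : List (Σ i : I, Σ m : ℕ, 𝒜 i m)) :
    ∀ h, fpDecomp 𝒜 (w.map fun s => FreeProduct.ι k A s.1 (s.2.2 : A s.1)).prod =
      DirectSum.of (fun n => fpPart 𝒜 n) (w.map fun s => s.2.1).sum
        ⟨(w.map fun s => FreeProduct.ι k A s.1 (s.2.2 : A s.1)).prod, h⟩ := by
  induction w with
  | nil =>
    intro h
    exact map_one (fpDecomp 𝒜)
  | cons s w ih =>
    intro h
    have e : (List.map (fun s => FreeProduct.ι k A s.1 (s.2.2 : A s.1)) (s :: w)).prod =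
      FreeProduct.ι k A s.1 (s.2.2 : A s.1) *
        (List.map (fun s => FreeProduct.ι k A s.1 (s.2.2 : A s.1)) w).prod := rfl
    refine (congrArg (fpDecomp 𝒜) e).trans ?_
    rw [map_mul, ih (Submodule.subset_span ⟨w, rfl, rfl⟩), fpDecomp_ι, fpIncl_of_mem,
      DirectSum.of_mul_of]
    exact of_eq_of rfl rfl

/-- A free product of graded algebras is graded. -/
noncomputable instance fpGraded : GradedAlgebra (fpPart 𝒜) :=
  GradedAlgebra.ofAlgHom _ (fpDecomp 𝒜)
    (by
      refine (FreeProduct.lift k A).symm.injective ?_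
      funext i
      refine AlgHom.ext fun x => ?_
      change DirectSum.coeAlgHom _ (fpDecomp 𝒜 (FreeProduct.ι k A i x)) = FreeProduct.ι k A i x
      rw [fpDecomp_ι]
      induction x using DirectSum.Decomposition.inductionOn (𝒜 i) with
      | zero => simp
      | homogeneous x => rw [fpIncl_of_mem, DirectSum.coeAlgHom_of]
      | add x y hx hy => rw [map_add, map_add, hx, hy, map_add])
    (by
      rintro n ⟨x, hx⟩
      induction hx using Submodule.span_induction with
      | mem x hx =>
        obtain ⟨w, rfl, rfl⟩ := hx
        exact fpDecomp_word 𝒜 w _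
      | zero => rw [map_zero]; exact (of_eq_zero rfl).symm
      | add x y hx hy ihx ihy =>
        simp only at ihx ihy ⊢
        rw [map_add, ihx, ihy, ← map_add]
        rfl
      | smul c x hx ihx =>
        simp only at ihx ⊢
        rw [map_smul, ihx, ← DirectSum.lof_eq_of k, ← DirectSum.lof_eq_of k, ← map_smul]
        rfl)

end FreeProduct

/-! ### The algebras `A`, `B` and `C` -/

/-- The generators of `A`. -/
inductive Letter : Type
  | a | b | c | d | e | f | l | m

section Example

variable (k : Type u) [Field k]

/-- The letter `x` in the free algebra `k⟨a, b, c, d, e, f, l, m⟩`. -/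
noncomputable abbrev gen (x : Letter) : FreeAlgebra k Letter := FreeAlgebra.ι k x

open Letter in
/-- The relations `bc - ef`, `ae`, `da - lm`, `cl`. -/
noncomputable def relsA : Set (FreeAlgebra k Letter) :=
  {gen k b * gen k c - gen k e * gen k f, gen k a * gen k e,
    gen k d * gen k a - gen k l * gen k m, gen k c * gen k l}

/-- The relation `z ^ 4` in the free algebra on one letter `z`. -/
noncomputable def relsB : Set (FreeAlgebra k Unit) := {FreeAlgebra.ι k () ^ 4}

/-- `A = k⟨a, b, c, d, e, f, l, m⟩ / (bc - ef, ae, da - lm, cl)`. -/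
abbrev AlgA : Type u := Presented (relsA k)

/-- `B = k⟨z⟩ / (z ^ 4)`. -/
abbrev AlgB : Type u := Presented (relsB k)

noncomputable instance : GradedAlgebra (presPart (relsA k)) :=
  presGraded _ fun p hp => ⟨2, by
    have h : ∀ x y, gen k x * gen k y ∈ freePart k Letter 2 := fun x y => by
      rw [freePart, pow_two]
      exact Submodule.mul_mem_mul (Submodule.subset_span ⟨x, rfl⟩)
        (Submodule.subset_span ⟨y, rfl⟩)
    rcases hp with rfl | rfl | rfl | rfl
    · exact sub_mem (h _ _) (h _ _)
    · exact h _ _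
    · exact sub_mem (h _ _) (h _ _)
    · exact h _ _⟩

noncomputable instance : GradedAlgebra (presPart (relsB k)) :=
  presGraded _ fun p hp => ⟨4, by
    rw [Set.mem_singleton_iff.1 hp]
    exact Submodule.pow_mem_pow _ (Submodule.subset_span (Set.mem_range_self ())) 4⟩

/-- The two factors `A`, `B` of the free product. -/
abbrev Factor : Fin 2 → Type u
  | 0 => AlgA k
  | 1 => AlgB k

noncomputable instance : ∀ i, Ring (Factor k i)
  | 0 => inferInstanceAs (Ring (AlgA k))
  | 1 => inferInstanceAs (Ring (AlgB k))

noncomputable instance : ∀ i, Algebra k (Factor k i)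
  | 0 => inferInstanceAs (Algebra k (AlgA k))
  | 1 => inferInstanceAs (Algebra k (AlgB k))

/-- The gradings of `A` and `B` by word length. -/
noncomputable def factorPart : ∀ i, ℕ → Submodule k (Factor k i)
  | 0 => presPart (relsA k)
  | 1 => presPart (relsB k)

noncomputable instance : ∀ i, GradedAlgebra (factorPart k i)
  | 0 => inferInstanceAs (GradedAlgebra (presPart (relsA k)))
  | 1 => inferInstanceAs (GradedAlgebra (presPart (relsB k)))

/-- The free product `C = A ⊔ B`. -/
abbrev AlgC : Type u := LinearAlgebra.FreeProduct k (Factor k)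

/-- The grading of `C`. -/
noncomputable abbrev gradingC : ℕ → Submodule k (AlgC k) := fpPart (factorPart k)

end Example

end Yoneda

/-! The proof works with left modules over `C`, with annihilators read off from a rewriting system.
Add `abc → 0` and `cda → 0` (consequences of the relations) to `ef → bc`, `lm → da`, `ae → 0`, `cl →
0`, `z⁴ → 0`. With this orientation, right multiplication of a word by `a`, `b`, `c`, `d` or `z`
either appends the letter or gives zero. Hence the left annihilators of `ab` and `a` are `C cd`,
those of `cd` and `c` are `C ab`, those of `z` and `z³` are `C z³` and `C z`, and those of `b` and
`d` are zero (`isDivision_ab` and its companions).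

If `t` has degree `s` and left annihilator `R t'`, the exact sequence `0 → (R/Rt')(-s) → R → R/Rt →
0` carries vanishing of `Ext^{i,j-s}(R/Rt', k)` to vanishing of `Ext^{i+1,j}(R/Rt, k)`
(`acyclic_succ`). Everything is done on explicit cochains: those with coefficients in `R/Rt` are the
cochains on `R` that vanish on `R t`.

Degree bound. As a left module, `C₊` is generated by the nine letters, with syzygies `b[c] - e[f]`,
`a[e]`, `d[a] - l[m]`, `c[l]`, `z³[z]`. They span a direct sum of two free modules and copies of
`Ca`, `Cc`, `Cz³`. The annihilators above make these resolutions periodic: the `ab`/`cd` branch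
gains 2 internal degrees per step, the `z` branch alternately 1 and 3, which produces `δ₄`.
`exists_gluesForm` carries this out by choosing primitives letter by letter so that they glue to a
primitive on `C₊`; the conclusion is `extComp_eq_bot`. The presentation is `ker_projC_renameGen`.

Infinite generation. Consider the bar word `cd, ab, cd, …, cd, a, e` with `2n + 3` letters. All its
adjacent products vanish, so coboundaries vanish on it (`coboundary_testWord`). Every cocycle
vanishes on its proper nonempty prefixes (`cocycle_testWord_of_append`), so evaluation at this word
is a derivation on cocycles over the augmentation `f ↦ f []`. It therefore kills any subalgebra
generated by cocycles that vanish there, in particular by cocycles of too small arity. Yet for each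
`n` some cocycle is nonzero on the word (`exists_cocycle_testWord`), so new generators are needed in
arbitrarily high cohomological degree. -/

namespace Yoneda

open WordFun

/-! ### Cobar cochains with coefficients in the free module of rank one -/

section ModForm

variable {k : Type u} [Field k] {R : Type v} [Ring R] [Algebra k R]
  {𝒜 : ℕ → Submodule k R} [GradedAlgebra 𝒜]

variable (𝒜) in
/-- Functions of words in `R₊` with values in the linear forms on `R`: the cochains of the bar
resolution of the left module `R`. -/
abbrev ModForm : Type (max u v) := List (augIdeal 𝒜) → R →ₗ[k] k

namespace ModForm

/-- Partial evaluation at the first letter. -/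
def tail (F : ModForm 𝒜) (x : augIdeal 𝒜) : ModForm 𝒜 := fun w => F (x :: w)

/-- The cobar differential with coefficients in `R`. -/
def diff (F : ModForm 𝒜) : List (augIdeal 𝒜) → R →ₗ[k] k
  | [] => 0
  | [x] => F [] ∘ₗ LinearMap.mulLeft k (x : R)
  | x :: y :: w => F ((x * y) :: w) - diff (F.tail x) (y :: w)

theorem diff_add_aux (w : List (augIdeal 𝒜)) : ∀ F G : ModForm 𝒜,
    diff (F + G) w = diff F w + diff G w := by
  induction w with
  | nil => intro F G; simp [diff]
  | cons x w ih =>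
    intro F G
    cases w with
    | nil => simp [diff, LinearMap.add_comp]
    | cons y w =>
      have : (F + G).tail x = F.tail x + G.tail x := rfl
      simp only [diff, this, ih, Pi.add_apply]; abel

theorem diff_smul_aux (c : k) (w : List (augIdeal 𝒜)) : ∀ F : ModForm 𝒜,
    diff (c • F) w = c • diff F w := by
  induction w with
  | nil => intro F; simp [diff]
  | cons x w ih =>
    intro F
    cases w with
    | nil => simp [diff, LinearMap.smul_comp]
    | cons y w =>
      have : (c • F).tail x = c • F.tail x := rfl
      simp only [diff, this, ih, Pi.smul_apply, smul_sub]

/-- The cobar differential as a linear map. -/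
def D : ModForm 𝒜 →ₗ[k] ModForm 𝒜 where
  toFun F := diff F
  map_add' F G := funext fun w => diff_add_aux w F G
  map_smul' c F := funext fun w => diff_smul_aux c w F

theorem D_nil (F : ModForm 𝒜) : D F [] = 0 := rfl
theorem D_single (F : ModForm 𝒜) (x : augIdeal 𝒜) (u : R) : D F [x] u = F [] (x * u) := rfl
theorem D_cons (F : ModForm 𝒜) (x y : augIdeal 𝒜) (w : List (augIdeal 𝒜)) :
    D F (x :: y :: w) = F ((x * y) :: w) - D (F.tail x) (y :: w) := rfl

/-- The function `F(x y, …)` of `(y, …)`. -/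
def mulHead (F : ModForm 𝒜) (x : augIdeal 𝒜) : ModForm 𝒜
  | [] => F [] ∘ₗ LinearMap.mulLeft k (x : R)
  | y :: w => F ((x * y) :: w)

theorem tail_D (F : ModForm 𝒜) (x : augIdeal 𝒜) :
    (D F).tail x = mulHead F x - D (F.tail x) :=
  funext fun w => by
    cases w with
    | nil => simp [tail, D_nil, mulHead]; rfl
    | cons y w => rfl

theorem D_D_aux (w : List (augIdeal 𝒜)) : ∀ F : ModForm 𝒜, D (D F) w = 0 := by
  induction w with
  | nil => intro F; rfl
  | cons x w ih =>
    intro F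
    cases w with
    | nil => ext u; rw [D_single, D_nil]; rfl
    | cons y w =>
      rw [D_cons, tail_D, map_sub, Pi.sub_apply, ih, sub_zero]
      cases w with
      | nil =>
        ext u
        rw [LinearMap.sub_apply, D_single, D_single]
        simp [mulHead, mul_assoc]
      | cons z w =>
        have : (mulHead F x).tail y = F.tail (x * y) := rfl
        rw [D_cons, D_cons, this]
        simp [mulHead, mul_assoc]

theorem D_D (F : ModForm 𝒜) : D (D F) = 0 := funext fun w => D_D_aux w F

/-- Precomposition with an endomorphism of `R`. -/
def comp (F : ModForm 𝒜) (φ : R →ₗ[k] R) : ModForm 𝒜 := fun w => F w ∘ₗ φ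

theorem comp_apply (F : ModForm 𝒜) (φ : R →ₗ[k] R) (w : List (augIdeal 𝒜)) (u : R) :
    F.comp φ w u = F w (φ u) := rfl

/-- Only the last merge touches the coefficient, and it does so by left multiplication; so
left-linear endomorphisms of `R` act on the complex. -/
theorem D_comp_aux {φ : R →ₗ[k] R} (hφ : ∀ x u, φ (x * u) = x * φ u)
    (w : List (augIdeal 𝒜)) : ∀ F : ModForm 𝒜, D (F.comp φ) w = (D F w) ∘ₗ φ := by
  induction w with
  | nil => intro F; rfl
  | cons x w ih =>
    intro F
    cases w with
    | nil => ext u; simp [D_single, comp_apply, hφ]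
    | cons y w =>
      have : (F.comp φ).tail x = (F.tail x).comp φ := rfl
      rw [D_cons, this, ih]; rfl

theorem D_comp {φ : R →ₗ[k] R} (hφ : ∀ x u, φ (x * u) = x * φ u) (F : ModForm 𝒜) :
    D (F.comp φ) = (D F).comp φ := funext fun w => D_comp_aux hφ w F

/-- The action of `R` on cochains by right multiplication on the last variable. -/
def rmul (F : ModForm 𝒜) (t : R) : ModForm 𝒜 := F.comp (LinearMap.mulRight k t)

theorem rmul_apply (F : ModForm 𝒜) (t : R) (w : List (augIdeal 𝒜)) (u : R) :
    F.rmul t w u = F w (u * t) := rfl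

theorem D_rmul (F : ModForm 𝒜) (t : R) : D (F.rmul t) = (D F).rmul t :=
  D_comp (fun x u => mul_assoc x u t) F

theorem sub_rmul (F G : ModForm 𝒜) (t : R) : (F - G).rmul t = F.rmul t - G.rmul t := rfl

theorem rmul_rmul (F : ModForm 𝒜) (s t : R) : (F.rmul t).rmul s = F.rmul (s * t) :=
  funext fun w => LinearMap.ext fun u => by simp only [rmul_apply, mul_assoc]

theorem rmul_zero (F : ModForm 𝒜) : F.rmul 0 = 0 :=
  funext fun w => LinearMap.ext fun u => by simp [rmul_apply]

theorem zero_rmul (t : R) : (0 : ModForm 𝒜).rmul t = 0 := rfl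

/-- `D F w u` is a signed sum of the values of `F` at all merges of neighbours, the last one
absorbing a letter into the coefficient. Support conditions can thus be checked term by term. -/
theorem D_eq_zero_of_merges (w : List (augIdeal 𝒜)) (u : R) : ∀ F : ModForm 𝒜,
    (∀ a x y b, w = a ++ x :: y :: b → F (a ++ (x * y) :: b) u = 0) →
    (∀ (a : List (augIdeal 𝒜)) (x : augIdeal 𝒜), w = a ++ [x] → F a (x * u) = 0) →
    D F w u = 0 := by
  induction w with
  | nil => intro F _ _; rfl
  | cons x w ih =>
    intro F h h'
    cases w with
    | nil => exact h' [] x rfl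
    | cons y w =>
      have h1 := h [] x y w rfl
      have h2 := ih (F.tail x) (fun a x' y' b hw => h (x :: a) x' y' b (by simp [hw]))
        (fun a x' hw => h' (x :: a) x' (by simp [hw]))
      rw [D_cons, LinearMap.sub_apply, h2, sub_zero]
      simpa using h1

/-- `F` is linear in each letter. -/
def IsMultilinear (F : ModForm 𝒜) : Prop :=
  ∀ (a b : List (augIdeal 𝒜)) (c : k) (x y : augIdeal 𝒜),
    F (a ++ (c • x + y) :: b) = c • F (a ++ x :: b) + F (a ++ y :: b)

theorem IsMultilinear.tail {F : ModForm 𝒜} (hF : IsMultilinear F) (x : augIdeal 𝒜) :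
    IsMultilinear (F.tail x) := fun a b => hF (x :: a) b

theorem IsMultilinear.tail_lin {F : ModForm 𝒜} (hF : IsMultilinear F) (c : k)
    (x y : augIdeal 𝒜) : F.tail (c • x + y) = c • F.tail x + F.tail y :=
  funext fun w => hF [] w c x y

theorem IsMultilinear.D {F : ModForm 𝒜} (hF : IsMultilinear F) : IsMultilinear (D F) := by
  intro a
  induction a generalizing F with
  | nil =>
    intro b c x y
    cases b with
    | nil => ext u; simp [D_single, add_mul]
    | cons z b =>
      have := hF [] b c (x * z) (y * z)
      simp only [List.nil_append] at this ⊢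
      rw [D_cons, D_cons, D_cons, add_mul, smul_mul_assoc, this, hF.tail_lin, map_add, map_smul,
        Pi.add_apply, Pi.smul_apply]
      module
  | cons z a ih =>
    intro b c x y
    have key := ih (hF.tail z) b c x y
    cases a with
    | nil =>
      have := hF [] b c (z * x) (z * y)
      simp only [List.nil_append, List.cons_append] at this key ⊢
      rw [D_cons, D_cons, D_cons, mul_add, mul_smul_comm, this, key]
      module
    | cons t a =>
      have := hF ((z * t) :: a) b c x y
      simp only [List.cons_append] at this key ⊢
      rw [D_cons, D_cons, D_cons, this, key]
      module

variable (𝒜) in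
/-- The cochains in `i` variables from `R₊`, supported in total internal degree `j`. -/
def coch (i : ℕ) (j : ℤ) : Submodule k (ModForm 𝒜) where
  carrier := {F | IsMultilinear F ∧ (∀ w, w.length ≠ i → F w = 0) ∧
    ∀ w ds n u, List.Forall₂ (fun (x : augIdeal 𝒜) (n : ℕ) => (x : R) ∈ 𝒜 n) w ds →
      u ∈ 𝒜 n → ((ds.sum + n : ℕ) : ℤ) ≠ j → F w u = 0}
  add_mem' {F G} hF hG := by
    refine ⟨fun a b c x y => ?_, fun w h => ?_, fun w ds n u h hu h' => ?_⟩
    · simp only [Pi.add_apply, hF.1 a b c x y, hG.1 a b c x y]; module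
    · rw [Pi.add_apply, hF.2.1 w h, hG.2.1 w h, add_zero]
    · rw [Pi.add_apply, LinearMap.add_apply, hF.2.2 w ds n u h hu h', hG.2.2 w ds n u h hu h',
        add_zero]
  zero_mem' := ⟨fun a b c x y => by simp, fun _ _ => rfl, fun _ _ _ _ _ _ _ => rfl⟩
  smul_mem' c F hF := by
    refine ⟨fun a b c x y => ?_, fun w h => ?_, fun w ds n u h hu h' => ?_⟩
    · simp only [Pi.smul_apply, hF.1 a b c x y]; module
    · rw [Pi.smul_apply, hF.2.1 w h, smul_zero]
    · rw [Pi.smul_apply, LinearMap.smul_apply, hF.2.2 w ds n u h hu h', smul_zero]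

theorem D_mem_coch {i : ℕ} {j : ℤ} {F : ModForm 𝒜} (hF : F ∈ coch 𝒜 i j) :
    D F ∈ coch 𝒜 (i + 1) j := by
  refine ⟨hF.1.D, fun w h => ?_, fun w ds n u h hu h' => ?_⟩
  · ext u
    refine D_eq_zero_of_merges w u F (fun a x y b hw => ?_) fun a x hw => ?_
    · rw [hF.2.1, LinearMap.zero_apply]
      subst hw
      simp only [List.length_append, List.length_cons] at h ⊢
      omega
    · rw [hF.2.1, LinearMap.zero_apply]
      subst hw
      simp only [List.length_append, List.length_cons, List.length_nil] at h ⊢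
      omega
  · refine D_eq_zero_of_merges w u F (fun a x y b hw => ?_) fun a x hw => ?_
    · subst hw
      obtain ⟨d₁, d₂, rfl, h₁, h₂⟩ := forall₂_append_split h
      cases h₂ with
      | cons hx h₂ =>
        cases h₂ with
        | @cons _ m _ d₂ hy h₂ =>
          rename_i p
          refine hF.2.2 _ (d₁ ++ (p + m) :: d₂) n u
            (forall₂_append_join h₁ (List.Forall₂.cons ?_ h₂)) hu fun hs => h' ?_
          · exact SetLike.mul_mem_graded hx hy
          · simp only [List.sum_append, List.sum_cons] at hs ⊢
            omega
    · subst hw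
      obtain ⟨d₁, d₂, rfl, h₁, h₂⟩ := forall₂_append_split h
      cases h₂ with
      | cons hx h₂ =>
        cases h₂
        rename_i p
        refine hF.2.2 a d₁ (p + n) _ h₁ (SetLike.mul_mem_graded hx hu) fun hs => h' ?_
        simp only [List.sum_append, List.sum_cons, List.sum_nil] at hs ⊢
        omega

variable (𝒜) in
/-- `φ` shifts internal degrees by `s`, where the parts of negative degree are zero. -/
def IsShift (φ : R →ₗ[k] R) (s : ℤ) : Prop :=
  ∀ n u, u ∈ 𝒜 n → φ u = 0 ∨ ∃ m, φ u ∈ 𝒜 m ∧ (m : ℤ) = n + s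

theorem isShift_mulRight {t : R} {s : ℕ} (ht : t ∈ 𝒜 s) :
    IsShift 𝒜 (LinearMap.mulRight k t) s :=
  fun n _ hu => Or.inr ⟨n + s, SetLike.mul_mem_graded hu ht, by push_cast; rfl⟩

/-- Cochains are dual to elements, so raising the degree of the coefficient by `s` lowers the degree
of the cochain by `s`. The result may be negative, which is why degrees here are integers. -/
theorem comp_mem_coch {i : ℕ} {j s : ℤ} {φ : R →ₗ[k] R} (hφ : IsShift 𝒜 φ s) {F : ModForm 𝒜}
    (hF : F ∈ coch 𝒜 i j) : F.comp φ ∈ coch 𝒜 i (j - s) := by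
  refine ⟨fun a b c x y => ?_, fun w h => ?_, fun w ds n u h hu h' => ?_⟩
  · simp only [comp, hF.1 a b c x y, LinearMap.add_comp, LinearMap.smul_comp]
  · simp only [comp, hF.2.1 w h, LinearMap.zero_comp]
  · rw [comp_apply]
    obtain h0 | ⟨m, hm, e⟩ := hφ n u hu
    · rw [h0, map_zero]
    · refine hF.2.2 w ds m _ h hm fun hs => h' ?_
      push_cast at hs ⊢
      omega

theorem rmul_mem_coch {i s : ℕ} {j : ℤ} {t : R} (ht : t ∈ 𝒜 s) {F : ModForm 𝒜}
    (hF : F ∈ coch 𝒜 i j) : F.rmul t ∈ coch 𝒜 i (j - s) :=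
  comp_mem_coch (isShift_mulRight ht) hF

/-! #### Passing between forms on `R₊` and forms with coefficients in `R` -/

/-- The value of `F` on a nonempty word, whose last letter is the argument from `R`. -/
def evalLast (F : ModForm 𝒜) : List (augIdeal 𝒜) → k
  | [] => 0
  | [u] => F [] u
  | x :: y :: w => evalLast (F.tail x) (y :: w)

/-- The form on `R₊` that is given by a cochain with coefficients in `R`. -/
def toWord (F : ModForm 𝒜) : WordFun k (augIdeal 𝒜) := evalLast F

theorem toWord_concat (w : List (augIdeal 𝒜)) (u : augIdeal 𝒜) : ∀ F : ModForm 𝒜,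
    toWord F (w ++ [u]) = F w u := by
  induction w with
  | nil => intro F; rfl
  | cons x w ih =>
    intro F
    cases w with
    | nil => rfl
    | cons y w => exact ih (F.tail x)

/-- No merge produces the empty word, so the value at `[]` is irrelevant. This matters because
`(toWord F).tail x` and `toWord (F.tail x)` can differ exactly there. -/
theorem d_congr_cons {N : Type*} [Mul N] {f g : WordFun k N}
    (h : ∀ x w, f (x :: w) = g (x :: w)) (x : N) (w : List N) : d f (x :: w) = d g (x :: w) := by
  rw [← sub_eq_zero, ← sub_ap, ← map_sub]
  refine d_eq_zero_of_merges _ _ fun a x y b _ => ?_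
  cases a <;> simp [sub_ap, h]

/-- Reading the coefficient as one more letter turns the last merge of `D` into an ordinary merge of
`d`; the arity goes up by one. -/
theorem d_toWord (w : List (augIdeal 𝒜)) (u : augIdeal 𝒜) : ∀ F : ModForm 𝒜,
    d (toWord F) (w ++ [u]) = D F w u := by
  induction w with
  | nil => intro F; rfl
  | cons x w ih =>
    intro F
    cases w with
    | nil =>
      simp only [List.cons_append, List.nil_append]
      rw [d_cons, d_single, sub_zero, D_single]; rfl
    | cons y w =>
      have h1 := toWord_concat ((x * y) :: w) u F
      have h2 := ih (F.tail x)
      simp only [List.cons_append] at h1 h2 ⊢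
      rw [d_cons, h1, D_cons, LinearMap.sub_apply, ← h2]
      exact congrArg (F ((x * y) :: w) u - ·) (d_congr_cons (f := (toWord F).tail x)
        (g := toWord (F.tail x)) (fun _ _ => rfl) y (w ++ [u]))

theorem toWord_mem_cobar {i j : ℕ} {F : ModForm 𝒜} (hF : F ∈ coch 𝒜 i j) :
    toWord F ∈ cobar 𝒜 (i + 1, j) := by
  refine ⟨isMultilinear_iff.2 fun a b c x y => ?_, fun w h => ?_, fun w ds h h' => ?_⟩
  · obtain rfl | ⟨b, u, rfl⟩ := b.eq_nil_or_concat'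
    · simp only [toWord_concat]
      simp
    · have h := fun x => toWord_concat (a ++ x :: b) u F
      simp only [List.append_assoc, List.cons_append] at h
      simp only [h, hF.1 a b c x y]
      simp
  · obtain rfl | ⟨w, u, rfl⟩ := w.eq_nil_or_concat'
    · rfl
    · rw [toWord_concat, hF.2.1, LinearMap.zero_apply]
      simp only [List.length_append, List.length_cons, List.length_nil] at h
      omega
  · obtain rfl | ⟨w, u, rfl⟩ := w.eq_nil_or_concat'
    · rfl
    · obtain ⟨d₁, d₂, rfl, h₁, h₂⟩ := forall₂_append_split h
      cases h₂ with
      | cons hx h₂ =>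
        cases h₂
        rw [toWord_concat]
        refine hF.2.2 w d₁ _ _ h₁ hx fun hs => h' ?_
        simp only [List.sum_append, List.sum_cons, List.sum_nil]
        exact_mod_cast hs

/-- The cochain `(w, u) ↦ f (w, φ u)` obtained from a form on `R₊` and a linear map
`φ : R → R₊`. -/
def ofWord (f : WordFun k (augIdeal 𝒜)) (hf : WordFun.IsMultilinear f)
    (φ : R →ₗ[k] augIdeal 𝒜) : ModForm 𝒜 :=
  fun w => (hf w []).mk' _ ∘ₗ φ

theorem ofWord_apply {f : WordFun k (augIdeal 𝒜)} (hf : WordFun.IsMultilinear f)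
    (φ : R →ₗ[k] augIdeal 𝒜) (w : List (augIdeal 𝒜)) (u : R) :
    ofWord f hf φ w u = f (w ++ [φ u]) := rfl

theorem ofWord_isMultilinear {f : WordFun k (augIdeal 𝒜)} (hf : WordFun.IsMultilinear f)
    (φ : R →ₗ[k] augIdeal 𝒜) : IsMultilinear (ofWord f hf φ) := fun a b c x y => by
  ext u
  simpa [ofWord_apply] using isMultilinear_iff.1 hf a (b ++ [φ u]) c x y

theorem D_ofWord {φ : R →ₗ[k] augIdeal 𝒜} (hφ : ∀ (x : augIdeal 𝒜) u, φ (x * u) = x * φ u)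
    (w : List (augIdeal 𝒜)) (u : R) : ∀ {f : WordFun k (augIdeal 𝒜)}
      (hf : WordFun.IsMultilinear f), D (ofWord f hf φ) w u = d f (w ++ [φ u]) := by
  induction w with
  | nil => intro f hf; rfl
  | cons x w ih =>
    intro f hf
    cases w with
    | nil =>
      rw [D_single, ofWord_apply, hφ]
      simp only [List.cons_append, List.nil_append]
      rw [d_cons, d_single, sub_zero]
    | cons y w =>
      have h2 := ih (hf.tail x)
      simp only [List.cons_append] at h2 ⊢
      rw [D_cons, LinearMap.sub_apply, d_cons, ← h2]
      rfl

theorem ofWord_mem_coch {i s : ℕ} {j : ℕ} {f : WordFun k (augIdeal 𝒜)}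
    (hf : f ∈ cobar 𝒜 (i + 1, j)) {φ : R →ₗ[k] augIdeal 𝒜}
    (hφ : ∀ n u, u ∈ 𝒜 n → (φ u : R) ∈ 𝒜 (n + s)) :
    ofWord f hf.1 φ ∈ coch 𝒜 i (j - s) := by
  refine ⟨ofWord_isMultilinear _ _, fun w h => ?_, fun w ds n u h hu h' => ?_⟩
  · ext u
    rw [ofWord_apply, hf.2.1, LinearMap.zero_apply]
    simp only [List.length_append, List.length_cons, List.length_nil]
    omega
  · rw [ofWord_apply]
    refine hf.2.2 _ (ds ++ [n + s]) (forall₂_append_join h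
      (List.Forall₂.cons (hφ n u hu) List.Forall₂.nil)) fun hs => h' ?_
    simp only [List.sum_append, List.sum_cons, List.sum_nil] at hs
    omega

end ModForm

end ModForm

/-! ### Vanishing of Ext for cyclic modules `R / R t`. -/

section Acyclic

variable {k : Type u} [Field k] {R : Type v} [Ring R] [Algebra k R]
  {𝒜 : ℕ → Submodule k R} [GradedAlgebra 𝒜]

theorem projZero_smul (c : k) (u : R) :
    GradedRing.projZeroRingHom 𝒜 (c • u) = c • GradedRing.projZeroRingHom 𝒜 u := by
  rw [GradedRing.projZeroRingHom_apply, DirectSum.decompose_smul,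
    GradedRing.projZeroRingHom_apply]
  rfl

theorem projZero_mem (u : R) : GradedRing.projZeroRingHom 𝒜 u ∈ 𝒜 0 := by
  rw [GradedRing.projZeroRingHom_apply]; exact SetLike.coe_mem _

theorem projZero_of_mem_zero {u : R} (hu : u ∈ 𝒜 0) : GradedRing.projZeroRingHom 𝒜 u = u := by
  rw [GradedRing.projZeroRingHom_apply, DirectSum.decompose_of_mem_same _ hu]

theorem projZero_of_mem {u : R} {n : ℕ} (hn : n ≠ 0) (hu : u ∈ 𝒜 n) :
    GradedRing.projZeroRingHom 𝒜 u = 0 := by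
  rw [GradedRing.projZeroRingHom_apply, DirectSum.decompose_of_mem_ne _ hu hn]

theorem mem_augIdeal {u : R} : u ∈ augIdeal 𝒜 ↔ GradedRing.projZeroRingHom 𝒜 u = 0 := Iff.rfl

variable (𝒜) in
/-- The projection of `R` onto `R₊`. -/
def posPart : R →ₗ[k] augIdeal 𝒜 where
  toFun u := ⟨u - GradedRing.projZeroRingHom 𝒜 u, by
    rw [mem_augIdeal, map_sub, projZero_of_mem_zero (projZero_mem u), sub_self]⟩
  map_add' u v := Subtype.ext (by simp only [map_add, NonUnitalSubalgebra.coe_add]; abel)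
  map_smul' c u := Subtype.ext (by
    simp only [projZero_smul, NonUnitalSubalgebra.coe_smul, RingHom.id_apply, smul_sub])

theorem coe_posPart (u : R) : (posPart 𝒜 u : R) = u - GradedRing.projZeroRingHom 𝒜 u := rfl

theorem posPart_mem {n : ℕ} {u : R} (hu : u ∈ 𝒜 n) : (posPart 𝒜 u : R) ∈ 𝒜 n := by
  rw [coe_posPart]
  obtain rfl | hn := eq_or_ne n 0
  · rw [projZero_of_mem_zero hu, sub_self]; exact zero_mem _
  · rwa [projZero_of_mem hn hu, sub_zero]

variable (𝒜) in
/-- `R₀` is spanned by `1`. -/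
def IsConnectedGrading : Prop := ∀ u ∈ 𝒜 0, ∃ c : k, u = c • (1 : R)

theorem exists_eq_posPart_add (hc : IsConnectedGrading 𝒜) (u : R) :
    ∃ c : k, u = posPart 𝒜 u + c • (1 : R) := by
  obtain ⟨c, h⟩ := hc _ (projZero_mem u)
  exact ⟨c, by rw [← h, coe_posPart, sub_add_cancel]⟩

namespace ModForm

/-- Evaluation of the argument from `R` at `1`. -/
def evalOne (F : ModForm 𝒜) : WordFun k (augIdeal 𝒜) := fun w => F w 1

theorem IsMultilinear.evalOne {F : ModForm 𝒜} (hF : IsMultilinear F) :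
    WordFun.IsMultilinear (evalOne F) :=
  isMultilinear_iff.2 fun a b c x y => by
    simp only [ModForm.evalOne, hF a b c x y]; rfl

/-- The contraction of the complex of cochains with coefficients in `R`. -/
def contract (F : ModForm 𝒜) (hF : IsMultilinear F) : ModForm 𝒜 :=
  ofWord (evalOne F) hF.evalOne (posPart 𝒜)

theorem contract_apply {F : ModForm 𝒜} (hF : IsMultilinear F) (w : List (augIdeal 𝒜)) (u : R) :
    contract F hF w u = F (w ++ [posPart 𝒜 u]) 1 := rfl

/-- This is the extra degeneracy of the bar resolution. Write `u = u₊ + c`. The two sides have the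
same merges inside the word; at its end, `(x u)₊ = c x + x u₊`, while `D F` has the additional term
in which `u₊` is absorbed into the coefficient. Together these account for the multiple of `F (x ::
w) u`. -/
theorem D_contract (hc : IsConnectedGrading 𝒜) (x : augIdeal 𝒜) (w : List (augIdeal 𝒜)) (u : R) :
    ∀ {F : ModForm 𝒜} (hF : IsMultilinear F), D (contract F hF) (x :: w) u =
      D F (x :: w ++ [posPart 𝒜 u]) 1 + (-1) ^ w.length * F (x :: w) u := by
  induction w generalizing x with
  | nil =>
    intro F hF
    obtain ⟨c, hu⟩ := exists_eq_posPart_add hc u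
    have e : posPart 𝒜 (x * u) = c • x + x * posPart 𝒜 u := by
      refine Subtype.ext ?_
      have h : (x : R) * u ∈ augIdeal 𝒜 := by
        rw [mem_augIdeal, map_mul, mem_augIdeal.1 x.2, zero_mul]
      rw [coe_posPart, mem_augIdeal.1 h, sub_zero]
      conv_lhs => rw [hu]
      simp [mul_add, add_comm]
    have h1 := congrArg (· 1) (hF [] [] c x (x * posPart 𝒜 u))
    have h2 : F [x] u = F [x] (posPart 𝒜 u) + c * F [x] 1 := by
      conv_lhs => rw [hu]
      simp
    simp only [List.nil_append, LinearMap.add_apply, LinearMap.smul_apply, smul_eq_mul] at h1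
    simp only [List.cons_append, List.nil_append]
    rw [D_single, contract_apply, List.nil_append, e, h1, D_cons, LinearMap.sub_apply, D_single,
      h2, mul_one]
    simp only [ModForm.tail, List.length_nil, pow_zero, one_mul]
    ring
  | cons y w ih =>
    intro F hF
    have h := ih y (hF.tail x)
    have e : (contract F hF).tail x = contract (F.tail x) (hF.tail x) := rfl
    simp only [List.cons_append] at h ⊢
    rw [D_cons, D_cons, LinearMap.sub_apply, LinearMap.sub_apply, e, h, contract_apply,
      List.length_cons, pow_succ]
    simp only [List.cons_append, ModForm.tail]
    ring

theorem contract_mem_coch {i : ℕ} {j : ℤ} {F : ModForm 𝒜} (hF : F ∈ coch 𝒜 (i + 1) j) :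
    contract F hF.1 ∈ coch 𝒜 i j := by
  refine ⟨ofWord_isMultilinear _ _, fun w h => ?_, fun w ds n u h hu h' => ?_⟩
  · ext u
    rw [contract_apply, hF.2.1, LinearMap.zero_apply, LinearMap.zero_apply]
    simp only [List.length_append, List.length_cons, List.length_nil]
    omega
  · rw [contract_apply]
    refine hF.2.2 _ (ds ++ [n]) 0 1 (forall₂_append_join h
      (List.Forall₂.cons (posPart_mem hu) List.Forall₂.nil)) SetLike.GradedOne.one_mem
      fun hs => h' ?_
    simpa [List.sum_append] using hs

/-- `R` is free, so it has no higher Ext; the sign undoes the one in `D_contract`. -/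
theorem exists_D_eq (hc : IsConnectedGrading 𝒜) {i : ℕ} {j : ℤ} {F : ModForm 𝒜}
    (hF : F ∈ coch 𝒜 (i + 1) j) (hD : D F = 0) : ∃ G ∈ coch 𝒜 i j, D G = F := by
  refine ⟨(-1 : k) ^ i • contract F hF.1, Submodule.smul_mem _ _ (contract_mem_coch hF),
    funext fun w => LinearMap.ext fun u => ?_⟩
  by_cases h : w.length = i + 1
  · obtain ⟨x, w, rfl⟩ := List.exists_cons_of_length_eq_add_one h
    have hl : w.length = i := by simpa using h
    rw [map_smul, Pi.smul_apply, LinearMap.smul_apply, D_contract hc, hD, hl, Pi.zero_apply,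
      LinearMap.zero_apply, zero_add, smul_eq_mul, ← mul_assoc, ← mul_pow]
    simp
  · rw [hF.2.1 w h, map_smul, Pi.smul_apply, (D_mem_coch (contract_mem_coch hF)).2.1 w h, smul_zero]

variable (𝒜) in
/-- The cochains that vanish on `R t`, i.e. those with coefficients in `R / R t`, form a complex
without cohomology in bidegree `(i, j)`. -/
def Acyclic (t : R) (j : ℤ) : ℕ → Prop
  | 0 => ∀ F ∈ coch 𝒜 0 j, D F = 0 → F.rmul t = 0 → F = 0
  | i + 1 => ∀ F ∈ coch 𝒜 (i + 1) j, D F = 0 → F.rmul t = 0 →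
      ∃ G ∈ coch 𝒜 i j, D G = F ∧ G.rmul t = 0

/-- A cocycle without variables is a linear form that kills `R₊`, so it is determined by its value
at `1`, which lives in internal degree 0. -/
theorem acyclic_zero (hc : IsConnectedGrading 𝒜) (t : R) {j : ℤ} (hj : j ≠ 0) :
    Acyclic 𝒜 t j 0 := fun F hF hD _ => by
  funext w
  by_cases h : w = []
  · subst h
    ext u
    obtain ⟨c, hu⟩ := exists_eq_posPart_add hc u
    have h1 : F [] (posPart 𝒜 u) = 0 := by
      have := D_single F (posPart 𝒜 u) 1
      rw [hD, mul_one] at this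
      exact this.symm
    have h2 : F [] 1 = 0 := hF.2.2 [] [] 0 1 List.Forall₂.nil SetLike.GradedOne.one_mem
      (by simpa using hj.symm)
    rw [hu, map_add, map_smul, h1, h2]; simp
  · exact hF.2.1 w (by simpa using h)

theorem acyclic_of_eq_zero (hc : IsConnectedGrading 𝒜) (j : ℤ) (i : ℕ) :
    Acyclic 𝒜 0 j (i + 1) := fun F hF hD _ => by
  obtain ⟨G, hG, h⟩ := exists_D_eq hc hF hD
  exact ⟨G, hG, h, rmul_zero G⟩

variable (𝒜) in
/-- The left annihilator of `t`, of degree `s`, is generated by `t'`, in the form: `σ` is a linear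
map that divides by `t` on the right. -/
structure IsDivision (t t' : R) (s : ℕ) (σ : R →ₗ[k] R) : Prop where
  mem : t ∈ 𝒜 s
  shift : IsShift 𝒜 σ (-s)
  mul_eq_zero : t' * t = 0
  div_mul : ∀ u, ∃ v, σ (u * t) = u + v * t'

/-- `σ (u t)` differs from `u` by an element of `R t'`, which `F` does not see. So every cochain on
`R/Rt'` extends along the embedding `R/Rt' → R` given by multiplication by `t`. -/
theorem comp_rmul_of_isDivision {t t' : R} {s : ℕ} {σ : R →ₗ[k] R} (hσ : IsDivision 𝒜 t t' s σ)
    {F : ModForm 𝒜} (hF : F.rmul t' = 0) : (F.comp σ).rmul t = F :=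
  funext fun w => LinearMap.ext fun u => by
    obtain ⟨v, hv⟩ := hσ.div_mul u
    have : F w (v * t') = 0 := congrArg (fun G : ModForm 𝒜 => G w v) hF
    rw [rmul_apply, comp_apply, hv, map_add, this, add_zero]

/-- A primitive of `F` can be chosen with prescribed restriction `q` to `R t`: for any primitive
`G`, the error `G.rmul t - q` is a cocycle on `R/Rt'`, and acyclicity there lets it be corrected.
Besides dimension shifting (`q = 0`), this serves to match two components over a relation such as
`bc = ef`. -/
theorem exists_D_eq_rmul_eq (hc : IsConnectedGrading 𝒜) {t t' : R} {s : ℕ} {σ : R →ₗ[k] R}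
    (hσ : IsDivision 𝒜 t t' s σ) {i : ℕ} {j : ℤ} (ha : Acyclic 𝒜 t' (j - s) i)
    {F : ModForm 𝒜} (hF : F ∈ coch 𝒜 (i + 1) j) (hD : D F = 0) {q : ModForm 𝒜}
    (hq : q ∈ coch 𝒜 i (j - s)) (hqD : D q = F.rmul t) (hqt : q.rmul t' = 0) :
    ∃ G ∈ coch 𝒜 i j, D G = F ∧ G.rmul t = q := by
  obtain ⟨G, hG, hGF⟩ := exists_D_eq hc hF hD
  have hG1 : G.rmul t - q ∈ coch 𝒜 i (j - s) := sub_mem (rmul_mem_coch hσ.mem hG) hq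
  have hG2 : D (G.rmul t - q) = 0 := by rw [map_sub, D_rmul, hGF, hqD, sub_self]
  have hG3 : (G.rmul t - q).rmul t' = 0 := by
    rw [sub_rmul, rmul_rmul, hσ.mul_eq_zero, rmul_zero, hqt, sub_zero]
  cases i with
  -- With no variables there are no coboundaries: acyclicity says that the error itself is zero.
  | zero => exact ⟨G, hG, hGF, sub_eq_zero.1 (ha _ hG1 hG2 hG3)⟩
  | succ i =>
    obtain ⟨h, hh, hhD, hht⟩ := ha _ hG1 hG2 hG3
    have hm : h.comp σ ∈ coch 𝒜 i j := by
      have := comp_mem_coch hσ.shift hh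
      rwa [sub_neg_eq_add, sub_add_cancel] at this
    refine ⟨G - D (h.comp σ), sub_mem hG (D_mem_coch hm), ?_, ?_⟩
    · rw [map_sub, D_D, sub_zero, hGF]
    · rw [sub_rmul, ← D_rmul, comp_rmul_of_isDivision hσ hht, hhD, sub_sub_cancel]

theorem acyclic_succ (hc : IsConnectedGrading 𝒜) {t t' : R} {s : ℕ} {σ : R →ₗ[k] R}
    (hσ : IsDivision 𝒜 t t' s σ) {i : ℕ} {j : ℤ} (ha : Acyclic 𝒜 t' (j - s) i) :
    Acyclic 𝒜 t j (i + 1) := fun F hF hD ht =>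
  exists_D_eq_rmul_eq hc hσ ha hF hD (zero_mem _) (by rw [map_zero, ht]) (zero_rmul _)

end ModForm

end Acyclic

/-! ### Rewriting in the algebra `C` -/

/-- The generators of `C`. -/
inductive Gen : Type
  | a | b | c | d | e | f | l | m | z

/-- There are nine generators. -/
def finEquivGen : Fin 9 ≃ Gen where
  toFun := ![.a, .b, .c, .d, .e, .f, .l, .m, .z]
  invFun
    | .a => 0 | .b => 1 | .c => 2 | .d => 3 | .e => 4 | .f => 5 | .l => 6 | .m => 7 | .z => 8
  left_inv i := by fin_cases i <;> rfl
  right_inv x := by cases x <;> rfl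

/-- The generators of `A`, as generators of `C`. -/
def Letter.toGen : Letter → Gen
  | .a => .a | .b => .b | .c => .c | .d => .d | .e => .e | .f => .f | .l => .l | .m => .m

/-- Words are stored with their last letter first. This is the product of a word with a letter,
rewritten by `ef = bc`, `lm = da` and `ae = cl = abc = cda = z⁴ = 0`. -/
def appendGen : Gen → List Gen → Option (List Gen)
  | .f, .e :: w => some (.c :: .b :: w)
  | .m, .l :: w => some (.a :: .d :: w)
  | .e, .a :: _ => none
  | .l, .c :: _ => none
  | .c, .b :: .a :: _ => none
  | .a, .d :: .c :: _ => none
  | .z, .z :: .z :: .z :: _ => none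
  | x, w => some (x :: w)

/-- These five identities say that the right action of the letters on words respects the relations
of `C`. They hold for all words, not only reduced ones, and take the place of a confluence check. -/
theorem appendGen_bc (w : List Gen) :
    (appendGen .b w).bind (appendGen .c) = (appendGen .e w).bind (appendGen .f) := by
  rcases w with _ | ⟨y, w⟩ <;> [rfl; (cases y <;> rfl)]

theorem appendGen_ae (w : List Gen) : (appendGen .a w).bind (appendGen .e) = none := by
  rcases w with _ | ⟨y, _ | ⟨x, w⟩⟩ <;> [rfl; (cases y <;> rfl); (cases y <;> cases x <;> rfl)]

theorem appendGen_da (w : List Gen) :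
    (appendGen .d w).bind (appendGen .a) = (appendGen .l w).bind (appendGen .m) := by
  rcases w with _ | ⟨y, w⟩ <;> [rfl; (cases y <;> rfl)]

theorem appendGen_cl (w : List Gen) : (appendGen .c w).bind (appendGen .l) = none := by
  rcases w with _ | ⟨y, _ | ⟨x, w⟩⟩ <;> [rfl; (cases y <;> rfl); (cases y <;> cases x <;> rfl)]

theorem appendGen_zzzz (w : List Gen) :
    (((appendGen .z w).bind (appendGen .z)).bind (appendGen .z)).bind (appendGen .z) = none := by
  have h : appendGen .z w = none ∨ appendGen .z w = some (.z :: w) := by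
    unfold appendGen; split <;> simp_all
  rcases h with h | h <;> rw [h]
  · rfl
  · rcases w with _ | ⟨y, _ | ⟨x, w⟩⟩ <;>
      [rfl; (cases y <;> rfl); (cases y <;> cases x <;> rfl)]

section RightAction

variable (k : Type u) [Field k]

/-- A word or zero, as a linear combination of words. -/
noncomputable def optWord : Option (List Gen) → (List Gen →₀ k)
  | none => 0
  | some w => Finsupp.single w 1

/-- Right multiplication by a generator on linear combinations of words. -/
noncomputable def rightMul (x : Gen) : Module.End k (List Gen →₀ k) :=
  Finsupp.linearCombination k fun w => optWord k (appendGen x w)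

theorem rightMul_single (x : Gen) (w : List Gen) :
    rightMul k x (Finsupp.single w 1) = optWord k (appendGen x w) := by
  simp [rightMul]

theorem rightMul_optWord (x : Gen) (o : Option (List Gen)) :
    rightMul k x (optWord k o) = optWord k (o.bind (appendGen x)) := by
  cases o with
  | none => exact map_zero _
  | some w => exact rightMul_single k x w

theorem linearMap_ext_words {M : Type*} [AddCommMonoid M] [Module k M]
    {φ ψ : (List Gen →₀ k) →ₗ[k] M}
    (h : ∀ w, φ (Finsupp.single w 1) = ψ (Finsupp.single w 1)) : φ = ψ :=
  Finsupp.lhom_ext' fun w => LinearMap.ext_ring (h w)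

/-- The action of the free algebra on words by right multiplication. -/
noncomputable def freeAct : FreeAlgebra k Gen →ₐ[k] (Module.End k (List Gen →₀ k))ᵐᵒᵖ :=
  FreeAlgebra.lift k fun x => MulOpposite.op (rightMul k x)

/-- The elements `Φ x` of an algebra satisfy the relations of `C`. -/
structure SatisfiesRels {T : Type*} [Ring T] (Φ : Gen → T) : Prop where
  bc : Φ .b * Φ .c = Φ .e * Φ .f
  ae : Φ .a * Φ .e = 0
  da : Φ .d * Φ .a = Φ .l * Φ .m
  cl : Φ .c * Φ .l = 0
  zzzz : Φ .z * Φ .z * Φ .z * Φ .z = 0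

theorem satisfiesRels_rightMul :
    SatisfiesRels fun x => MulOpposite.op (rightMul k x) := by
  constructor <;> refine MulOpposite.unop_injective (linearMap_ext_words k fun w => ?_) <;>
    simp only [MulOpposite.unop_mul, MulOpposite.unop_op, Module.End.mul_apply, rightMul_single,
      rightMul_optWord, appendGen_bc, appendGen_ae, appendGen_da, appendGen_cl, appendGen_zzzz] <;>
    rfl

/-! ### Evaluation of words in algebras that satisfy the relations. -/

section Eval

variable {k} {T : Type*} [Ring T] [Algebra k T] (Φ : Gen → T)

/-- The value of a word. -/
def evalWord : List Gen → T
  | [] => 1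
  | x :: w => evalWord w * Φ x

variable (k) in
/-- The value of a linear combination of words. -/
noncomputable def evalComb : (List Gen →₀ k) →ₗ[k] T :=
  Finsupp.linearCombination k (evalWord Φ)

theorem evalComb_single (w : List Gen) :
    evalComb k Φ (Finsupp.single w 1) = evalWord Φ w := by
  simp [evalComb]

variable {Φ}

theorem SatisfiesRels.abc (h : SatisfiesRels Φ) : Φ .a * Φ .b * Φ .c = 0 := by
  rw [mul_assoc, h.bc, ← mul_assoc, h.ae, zero_mul]

theorem SatisfiesRels.cda (h : SatisfiesRels Φ) : Φ .c * Φ .d * Φ .a = 0 := by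
  rw [mul_assoc, h.da, ← mul_assoc, h.cl, zero_mul]

/-- Soundness of the rewriting rules; `abc → 0` and `cda → 0` are the derived ones. The target is an
arbitrary algebra because `ker_projC_renameGen` evaluates normal forms in a quotient of the free
algebra instead of `C`. -/
theorem evalComb_appendGen (h : SatisfiesRels Φ) (x : Gen) (w : List Gen) :
    evalComb k Φ (optWord k (appendGen x w)) = evalWord Φ w * Φ x := by
  have h1 := h.abc
  have h2 := h.cda
  unfold appendGen
  split <;> simp only [optWord, evalComb_single, map_zero, evalWord]
  · rw [mul_assoc, h.bc, mul_assoc]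
  · rw [mul_assoc, h.da, mul_assoc]
  · rw [mul_assoc, h.ae, mul_zero]
  · rw [mul_assoc, h.cl, mul_zero]
  · rw [mul_assoc, mul_assoc, ← mul_assoc (Φ _), h1, mul_zero]
  · rw [mul_assoc, mul_assoc, ← mul_assoc (Φ _), h2, mul_zero]
  · have := h.zzzz
    simp only [mul_assoc] at this ⊢
    rw [this, mul_zero]

theorem evalComb_rightMul (h : SatisfiesRels Φ) (x : Gen) (v : List Gen →₀ k) :
    evalComb k Φ (rightMul k x v) = evalComb k Φ v * Φ x := by
  have : evalComb k Φ ∘ₗ rightMul k x = LinearMap.mulRight k (Φ x) ∘ₗ evalComb k Φ :=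
    linearMap_ext_words k fun w => by
      simp only [LinearMap.comp_apply, rightMul_single, evalComb_appendGen h, evalComb_single,
        LinearMap.mulRight_apply]
  exact LinearMap.congr_fun this v

theorem evalComb_freeAct (h : SatisfiesRels Φ) (p : FreeAlgebra k Gen) :
    ∀ v, evalComb k Φ ((freeAct k p).unop v) = evalComb k Φ v * FreeAlgebra.lift k Φ p := by
  induction p using FreeAlgebra.induction with
  | grade0 r =>
    intro v
    simp [Algebra.algebraMap_eq_smul_one]
  | grade1 x =>
    intro v
    simp [freeAct, evalComb_rightMul h]
  | mul p q hp hq =>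
    intro v
    rw [map_mul, MulOpposite.unop_mul, Module.End.mul_apply, hq, hp, map_mul, mul_assoc]
  | add p q hp hq =>
    intro v
    rw [map_add, MulOpposite.unop_add, LinearMap.add_apply, map_add, hp, hq, map_add, mul_add]

end Eval

end RightAction

/-! ### The structure of `C` -/

section AlgC

open LinearAlgebra

variable (k : Type u) [Field k]

/-- The generators of `C` as elements of `C`. -/
noncomputable def genC : Gen → AlgC k
  | .a => FreeProduct.ι k (Factor k) 0 (proj (relsA k) (gen k .a))
  | .b => FreeProduct.ι k (Factor k) 0 (proj (relsA k) (gen k .b))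
  | .c => FreeProduct.ι k (Factor k) 0 (proj (relsA k) (gen k .c))
  | .d => FreeProduct.ι k (Factor k) 0 (proj (relsA k) (gen k .d))
  | .e => FreeProduct.ι k (Factor k) 0 (proj (relsA k) (gen k .e))
  | .f => FreeProduct.ι k (Factor k) 0 (proj (relsA k) (gen k .f))
  | .l => FreeProduct.ι k (Factor k) 0 (proj (relsA k) (gen k .l))
  | .m => FreeProduct.ι k (Factor k) 0 (proj (relsA k) (gen k .m))
  | .z => FreeProduct.ι k (Factor k) 1 (proj (relsB k) (FreeAlgebra.ι k ()))

theorem genC_toGen (x : Letter) :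
    genC k x.toGen = FreeProduct.ι k (Factor k) 0 (proj (relsA k) (gen k x)) := by
  cases x <;> rfl

/-- The quotient map from the free algebra on the generators to `C`. -/
noncomputable def projC : FreeAlgebra k Gen →ₐ[k] AlgC k := FreeAlgebra.lift k (genC k)

theorem proj_eq_zero {X : Type w} {rels : Set (FreeAlgebra k X)} {p : FreeAlgebra k X}
    (hp : p ∈ rels) : proj rels p = 0 := by
  have := RingQuot.mkAlgHom_rel k
    (s := fun p q : FreeAlgebra k X => p ∈ rels ∧ q = 0) (x := p) (y := 0) ⟨hp, rfl⟩
  rwa [map_zero] at this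

theorem satisfiesRels_genC : SatisfiesRels (genC k) where
  bc := by
    simp only [genC, ← map_mul]
    rw [← sub_eq_zero, ← map_sub, ← map_sub, proj_eq_zero k (by simp [relsA]), map_zero]
  ae := by
    simp only [genC, ← map_mul]
    rw [proj_eq_zero k (by simp [relsA]), map_zero]
  da := by
    simp only [genC, ← map_mul]
    rw [← sub_eq_zero, ← map_sub, ← map_sub, proj_eq_zero k (by simp [relsA]), map_zero]
  cl := by
    simp only [genC, ← map_mul]
    rw [proj_eq_zero k (by simp [relsA]), map_zero]
  zzzz := by
    simp only [genC, ← map_mul]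
    rw [proj_eq_zero k (by simp [relsB, pow_succ]), map_zero]

/-- The map from `A` to an algebra that is given by elements satisfying the relations. -/
noncomputable def liftA {T : Type*} [Ring T] [Algebra k T] {Φ : Gen → T} (h : SatisfiesRels Φ) :
    AlgA k →ₐ[k] T :=
  RingQuot.liftAlgHom k ⟨FreeAlgebra.lift k fun x : Letter => Φ x.toGen, by
    rintro p _ ⟨hp, rfl⟩
    rw [map_zero]
    rcases hp with rfl | rfl | rfl | rfl
    · simp [Letter.toGen, h.bc]
    · simp [Letter.toGen, h.ae]
    · simp [Letter.toGen, h.da]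
    · simp [Letter.toGen, h.cl]⟩

theorem liftA_proj {T : Type*} [Ring T] [Algebra k T] {Φ : Gen → T} (h : SatisfiesRels Φ)
    (x : Letter) : liftA k h (proj (relsA k) (gen k x)) = Φ x.toGen :=
  (RingQuot.liftAlgHom_mkAlgHom_apply _ _ _ _).trans (FreeAlgebra.lift_ι_apply _ _)

/-- The map from `B` to an algebra that is given by elements satisfying the relations. -/
noncomputable def liftB {T : Type*} [Ring T] [Algebra k T] {Φ : Gen → T} (h : SatisfiesRels Φ) :
    AlgB k →ₐ[k] T :=
  RingQuot.liftAlgHom k ⟨FreeAlgebra.lift k fun _ : Unit => Φ .z, by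
    rintro p _ ⟨hp, rfl⟩
    rw [map_zero, Set.mem_singleton_iff.1 hp]
    simp [pow_succ, h.zzzz]⟩

theorem liftB_proj {T : Type*} [Ring T] [Algebra k T] {Φ : Gen → T} (h : SatisfiesRels Φ) :
    liftB k h (proj (relsB k) (FreeAlgebra.ι k ())) = Φ .z :=
  (RingQuot.liftAlgHom_mkAlgHom_apply _ _ _ _).trans (FreeAlgebra.lift_ι_apply _ _)

/-- The maps on the factors that are given by elements satisfying the relations. -/
noncomputable def liftFactor {T : Type*} [Ring T] [Algebra k T] {Φ : Gen → T}
    (h : SatisfiesRels Φ) : ∀ i, Factor k i →ₐ[k] T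
  | 0 => liftA k h
  | 1 => liftB k h

/-- The map from `C` to an algebra that is given by elements satisfying the relations. -/
noncomputable def liftC {T : Type*} [Ring T] [Algebra k T] {Φ : Gen → T} (h : SatisfiesRels Φ) :
    AlgC k →ₐ[k] T :=
  FreeProduct.lift k (Factor k) fun {i} => liftFactor k h i

theorem liftC_ι {T : Type*} [Ring T] [Algebra k T] {Φ : Gen → T} (h : SatisfiesRels Φ)
    (i : Fin 2) (x : Factor k i) :
    liftC k h (FreeProduct.ι k (Factor k) i x) = liftFactor k h i x :=
  DFunLike.congr_fun (FreeProduct.lift_comp_ι (i := i) k (Factor k)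
    fun {i} => liftFactor k h i) x

theorem liftC_genC {T : Type*} [Ring T] [Algebra k T] {Φ : Gen → T} (h : SatisfiesRels Φ)
    (x : Gen) : liftC k h (genC k x) = Φ x := by
  cases x <;> simp only [genC] <;> rw [liftC_ι] <;>
    first | exact liftA_proj k h _ | exact liftB_proj k h

theorem liftC_projC {T : Type*} [Ring T] [Algebra k T] {Φ : Gen → T} (h : SatisfiesRels Φ)
    (p : FreeAlgebra k Gen) : liftC k h (projC k p) = FreeAlgebra.lift k Φ p := by
  have : (liftC k h).comp (projC k) = FreeAlgebra.lift k Φ :=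
    FreeAlgebra.hom_ext (funext fun x => by simp [projC, liftC_genC])
  exact DFunLike.congr_fun this p

/-- The expression of elements of `A` by generators of `C`. -/
theorem ι_projA (p : FreeAlgebra k Letter) :
    FreeProduct.ι k (Factor k) 0 (proj (relsA k) p) =
      projC k (FreeAlgebra.lift k (fun x : Letter => FreeAlgebra.ι k x.toGen) p) := by
  have : ((FreeProduct.ι k (Factor k) 0).comp (proj (relsA k))) =
      (projC k).comp (FreeAlgebra.lift k fun x : Letter => FreeAlgebra.ι k x.toGen) :=
    FreeAlgebra.hom_ext (funext fun x => by simp [projC, genC_toGen])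
  exact DFunLike.congr_fun this p

theorem ι_projB (p : FreeAlgebra k Unit) :
    FreeProduct.ι k (Factor k) 1 (proj (relsB k) p) =
      projC k (FreeAlgebra.lift k (fun _ => FreeAlgebra.ι k Gen.z) p) := by
  have : ((FreeProduct.ι k (Factor k) 1).comp (proj (relsB k))) =
      (projC k).comp (FreeAlgebra.lift k fun _ => FreeAlgebra.ι k Gen.z) :=
    FreeAlgebra.hom_ext (funext fun x => by simp [projC, genC])
  exact DFunLike.congr_fun this p

theorem lift_mem_freePart {X Y : Type*} (g : X → Y) {n : ℕ} {p : FreeAlgebra k X}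
    (hp : p ∈ freePart k X n) :
    FreeAlgebra.lift k (fun x => FreeAlgebra.ι k (g x)) p ∈ freePart k Y n := by
  have h := Submodule.mem_map_of_mem
    (f := (FreeAlgebra.lift k fun x => FreeAlgebra.ι k (g x)).toLinearMap) hp
  rw [freePart, Submodule.map_pow, Submodule.map_span] at h
  refine pow_le_pow_left' (Submodule.span_mono ?_) n h
  rintro _ ⟨_, ⟨x, rfl⟩, rfl⟩
  exact ⟨g x, by simp⟩

theorem factorPart_le (i : Fin 2) {n : ℕ} {x : Factor k i} (hx : x ∈ factorPart k i n) :
    FreeProduct.ι k (Factor k) i x ∈ (freePart k Gen n).map (projC k).toLinearMap := by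
  match i with
  | 0 =>
    obtain ⟨p, hp, rfl⟩ := hx
    exact ⟨_, lift_mem_freePart k Letter.toGen hp, (ι_projA k p).symm⟩
  | 1 =>
    obtain ⟨p, hp, rfl⟩ := hx
    exact ⟨_, lift_mem_freePart k (fun _ => Gen.z) hp, (ι_projB k p).symm⟩

/-- This links the grading of the free product, defined through the two factors, to word length in
all nine letters. -/
theorem gradingC_le (n : ℕ) : gradingC k n ≤ (freePart k Gen n).map (projC k).toLinearMap := by
  refine Submodule.span_le.2 ?_
  rintro _ ⟨w, rfl, rfl⟩
  induction w with
  | nil => exact ⟨1, by simp [freePart], map_one (projC k)⟩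
  | cons s w ih =>
    obtain ⟨p, hp, h⟩ := factorPart_le k s.1 s.2.2.2
    obtain ⟨q, hq, h'⟩ := ih
    refine ⟨p * q, ?_, ?_⟩
    · rw [List.map_cons, List.sum_cons, freePart, pow_add]
      exact Submodule.mul_mem_mul hp hq
    · rw [List.map_cons, List.prod_cons]
      change projC k (p * q) = _
      rw [map_mul]
      exact congrArg₂ (· * ·) h h'

theorem genC_mem (x : Gen) : genC k x ∈ gradingC k 1 := by
  have hA : ∀ y : Letter, proj (relsA k) (gen k y) ∈ factorPart k 0 1 := fun y =>
    ⟨gen k y, by simpa [freePart] using Submodule.subset_span (Set.mem_range_self y), rfl⟩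
  have hB : proj (relsB k) (FreeAlgebra.ι k ()) ∈ factorPart k 1 1 :=
    ⟨_, by simpa [freePart] using Submodule.subset_span (Set.mem_range_self ()), rfl⟩
  cases x <;> first
    | exact ι_mem_fpPart (factorPart k) (hA _)
    | exact ι_mem_fpPart (factorPart k) hB

theorem projC_mem {n : ℕ} {p : FreeAlgebra k Gen} (hp : p ∈ freePart k Gen n) :
    projC k p ∈ gradingC k n := by
  unfold freePart at hp
  induction hp using Submodule.pow_induction_on_left' with
  | algebraMap r =>
    rw [AlgHom.commutes]
    exact SetLike.algebraMap_mem_graded (gradingC k) r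
  | add x y i hx hy ihx ihy => rw [map_add]; exact add_mem ihx ihy
  | mem_mul m hm i x hx ih =>
    rw [map_mul, Nat.succ_eq_add_one, add_comm]
    refine SetLike.mul_mem_graded ?_ ih
    induction hm using Submodule.span_induction with
    | mem y hy =>
      obtain ⟨y, rfl⟩ := hy
      simpa [projC] using genC_mem k y
    | zero => rw [map_zero]; exact zero_mem _
    | add y z _ _ hy hz => rw [map_add]; exact add_mem hy hz
    | smul c y _ hy => rw [map_smul]; exact Submodule.smul_mem _ _ hy

theorem projC_surjective : Function.Surjective (projC k) := fun u => by
  induction u using DirectSum.Decomposition.inductionOn (gradingC k) with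
  | zero => exact ⟨0, map_zero _⟩
  | homogeneous u =>
    obtain ⟨p, -, h⟩ := gradingC_le k _ u.2
    exact ⟨p, h⟩
  | add u v hu hv =>
    obtain ⟨p, rfl⟩ := hu
    obtain ⟨q, rfl⟩ := hv
    exact ⟨p + q, map_add _ _ _⟩

/-! ### Normal forms in `C`. -/

/-- The right action of `C` on words. -/
noncomputable def actC : AlgC k →ₐ[k] (Module.End k (List Gen →₀ k))ᵐᵒᵖ :=
  liftC k (satisfiesRels_rightMul k)

/-- The normal form of an element of `C`. -/
noncomputable def nf : AlgC k →ₗ[k] (List Gen →₀ k) where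
  toFun u := (actC k u).unop (Finsupp.single [] 1)
  map_add' u v := by rw [map_add]; rfl
  map_smul' c u := by rw [map_smul]; rfl

theorem nf_projC (p : FreeAlgebra k Gen) :
    nf k (projC k p) = (freeAct k p).unop (Finsupp.single [] 1) :=
  congrArg (fun φ : (Module.End k (List Gen →₀ k))ᵐᵒᵖ => φ.unop (Finsupp.single [] 1))
    (liftC_projC k (satisfiesRels_rightMul k) p)

theorem nf_one : nf k 1 = Finsupp.single [] 1 := by
  change (actC k 1).unop _ = _
  rw [map_one]; rfl

theorem nf_mul_genC (u : AlgC k) (x : Gen) : nf k (u * genC k x) = rightMul k x (nf k u) := by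
  change (actC k (u * genC k x)).unop _ = _
  rw [map_mul, actC, liftC_genC, MulOpposite.unop_mul]
  rfl

/-- The value in `C` of a word. -/
noncomputable abbrev wordC (w : List Gen) : AlgC k := evalWord (genC k) w

/-- Hence `nf` is injective. This is all that is needed about normal forms; the reduced words are
never shown to be a basis. -/
theorem eval_nf (u : AlgC k) : evalComb k (genC k) (nf k u) = u := by
  obtain ⟨p, rfl⟩ := projC_surjective k u
  rw [nf_projC, evalComb_freeAct (satisfiesRels_genC k), evalComb_single, evalWord, one_mul]
  rfl

theorem wordC_mem (w : List Gen) : wordC k w ∈ gradingC k w.length := by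
  induction w with
  | nil => exact SetLike.GradedOne.one_mem
  | cons x w ih => exact SetLike.mul_mem_graded ih (genC_mem k x)

theorem length_appendGen {x : Gen} {w v : List Gen} (h : appendGen x w = some v) :
    v.length = w.length + 1 := by
  unfold appendGen at h
  split at h <;> simp at h <;> subst h <;> simp

/-- The linear combinations of words of length `n`. -/
abbrev wordsOfLength (n : ℕ) : Submodule k (List Gen →₀ k) :=
  Finsupp.supported k k {w | w.length = n}

theorem rightMul_mem {x : Gen} {n : ℕ} {v : List Gen →₀ k} (hv : v ∈ wordsOfLength k n) :
    rightMul k x v ∈ wordsOfLength k (n + 1) := by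
  rw [rightMul, Finsupp.linearCombination_apply]
  refine Submodule.sum_mem _ fun w hw => Submodule.smul_mem _ _ ?_
  have hl : w.length = n := hv hw
  cases h : appendGen x w with
  | none => exact zero_mem _
  | some y => exact Finsupp.single_mem_supported k 1 (by
      rw [Set.mem_ofPred_eq, length_appendGen h, hl])

theorem nf_mem {n : ℕ} {u : AlgC k} (hu : u ∈ gradingC k n) : nf k u ∈ wordsOfLength k n := by
  obtain ⟨p, hp, rfl⟩ := gradingC_le k n hu
  change nf k (projC k p) ∈ _
  unfold freePart at hp
  induction hp using Submodule.pow_induction_on_right' with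
  | algebraMap r =>
    rw [AlgHom.commutes, Algebra.algebraMap_eq_smul_one, map_smul, nf_one]
    exact Submodule.smul_mem _ _ (Finsupp.single_mem_supported k 1 rfl)
  | add x y i hx hy ihx ihy =>
    rw [map_add, map_add]
    exact add_mem (ihx (projC_mem k hx)) (ihy (projC_mem k hy))
  | mul_mem i x hx ih m hm =>
    have ih := ih (projC_mem k hx)
    rw [map_mul]
    clear hu
    induction hm using Submodule.span_induction with
    | mem y hy =>
      obtain ⟨y, rfl⟩ := hy
      rw [projC, FreeAlgebra.lift_ι_apply, nf_mul_genC]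
      exact rightMul_mem k ih
    | zero => rw [map_zero, mul_zero, map_zero]; exact zero_mem _
    | add y z _ _ hy hz => rw [map_add, mul_add, map_add]; exact add_mem hy hz
    | smul c y _ hy =>
      rw [map_smul, mul_smul_comm, map_smul]; exact Submodule.smul_mem _ _ hy

theorem isConnected_gradingC : IsConnectedGrading (gradingC k) := fun u hu => by
  obtain ⟨p, hp, rfl⟩ := gradingC_le k 0 hu
  rw [freePart, pow_zero] at hp
  obtain ⟨c, rfl⟩ := Submodule.mem_one.1 hp
  exact ⟨c, by
    change projC k _ = _
    rw [AlgHom.commutes, Algebra.algebraMap_eq_smul_one]⟩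

end AlgC

/-! ### Division by words in `C` -/

/-- The product of the word `w` with the word `p`, rewritten. -/
def appendWord : List Gen → List Gen → Option (List Gen)
  | [], w => some w
  | x :: p, w => (appendWord p w).bind (appendGen x)

section Division

open ModForm

variable (k : Type u) [Field k]

theorem wordC_append (p w : List Gen) : wordC k (p ++ w) = wordC k w * wordC k p := by
  induction p with
  | nil => simp [evalWord]
  | cons x p ih =>
    change wordC k (p ++ w) * genC k x = wordC k w * (wordC k p * genC k x)
    rw [ih, mul_assoc]

theorem nf_mul_wordC (p : List Gen) (u : AlgC k) : nf k (u * wordC k p) =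
    Finsupp.linearCombination k (fun w => optWord k (appendWord p w)) (nf k u) := by
  induction p with
  | nil =>
    have : (fun w => optWord k (appendWord [] w)) = fun w => Finsupp.single w (1 : k) := rfl
    simp [evalWord, this, Finsupp.linearCombination_apply]
  | cons x p ih =>
    change nf k (u * (wordC k p * genC k x)) = _
    rw [← mul_assoc, nf_mul_genC, ih]
    refine LinearMap.congr_fun (f := rightMul k x ∘ₗ _) (linearMap_ext_words k fun w => ?_) _
    simp [rightMul_optWord, appendWord]

/-- The linear map that removes the suffix `p` from words in normal form, and sends the words
without this suffix to zero. -/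
noncomputable def divC (p : List Gen) : AlgC k →ₗ[k] AlgC k :=
  evalComb k (genC k) ∘ₗ
    Finsupp.lcomapDomain (p ++ ·) (fun _ _ h => List.append_cancel_left h) ∘ₗ nf k

theorem evalComb_mem {n : ℕ} {v : List Gen →₀ k} (hv : v ∈ wordsOfLength k n) :
    evalComb k (genC k) v ∈ gradingC k n := by
  rw [evalComb, Finsupp.linearCombination_apply]
  refine Submodule.sum_mem _ fun w hw => Submodule.smul_mem _ _ ?_
  have hl : w.length = n := hv hw
  exact hl ▸ wordC_mem k w

theorem isShift_divC (p : List Gen) : IsShift (gradingC k) (divC k p) (-p.length) := by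
  intro n u hu
  have hs := nf_mem k hu
  rw [Finsupp.mem_supported'] at hs
  by_cases hn : p.length ≤ n
  · refine Or.inr ⟨n - p.length, evalComb_mem k ?_, by omega⟩
    rw [Finsupp.mem_supported']
    intro w hw
    refine hs _ fun h => hw ?_
    simp only [Set.mem_ofPred_eq, List.length_append] at h ⊢
    omega
  -- Words shorter than `p` cannot have `p` as a suffix.
  · left
    rw [divC, LinearMap.comp_apply, LinearMap.comp_apply]
    convert map_zero (evalComb k (genC k))
    ext w
    refine hs _ fun h => hn ?_
    simp only [Set.mem_ofPred_eq, List.length_append] at h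
    omega

theorem comapDomain_single_append (p w : List Gen) :
    Finsupp.lcomapDomain (R := k) (p ++ ·) (fun _ _ h => List.append_cancel_left h)
      (Finsupp.single (p ++ w) 1) = Finsupp.single w (1 : k) := by
  classical
  ext v
  change Finsupp.single (p ++ w) (1 : k) (p ++ v) = _
  simp [Finsupp.single_apply]

theorem map_words_mem {M : Type*} [AddCommGroup M] [Module k M] {S : Submodule k M}
    (γ : (List Gen →₀ k) →ₗ[k] M) (h : ∀ w, γ (Finsupp.single w 1) ∈ S)
    (v : List Gen →₀ k) : γ v ∈ S := by
  induction v using Finsupp.induction_linear with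
  | zero => rw [map_zero]; exact zero_mem _
  | add v₁ v₂ h₁ h₂ => rw [map_add]; exact add_mem h₁ h₂
  | single w c =>
    rw [← mul_one c, ← smul_eq_mul, ← Finsupp.smul_single, map_smul]
    exact Submodule.smul_mem _ _ (h w)

/-- The annihilator of `p` is visible on single words: either `p` is appended unchanged and can be
stripped off again, or the product is zero and the word is already a left multiple of `t'`. -/
theorem isDivision_divC {p : List Gen} {t' : AlgC k} (h0 : t' * wordC k p = 0)
    (h : ∀ w, appendWord p w = some (p ++ w) ∨
      appendWord p w = none ∧ ∃ v, wordC k w = v * t') :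
    IsDivision (gradingC k) (wordC k p) t' p.length (divC k p) where
  mem := wordC_mem k p
  shift := isShift_divC k p
  mul_eq_zero := h0
  div_mul u := by
    -- By linearity, appending `p` and stripping it off differs from plain evaluation only by
    -- elements of `C t'`.
    have key := map_words_mem k (S := LinearMap.range (LinearMap.mulRight k t'))
      (evalComb k (genC k) ∘ₗ Finsupp.lcomapDomain (p ++ ·)
        (fun _ _ h => List.append_cancel_left h) ∘ₗ
        Finsupp.linearCombination k (fun w => optWord k (appendWord p w)) -
          evalComb k (genC k)) (fun w => by
        rw [LinearMap.sub_apply, LinearMap.comp_apply, LinearMap.comp_apply, evalComb_single,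
          Finsupp.linearCombination_single, one_smul]
        rcases h w with h | ⟨h, y, hy⟩
        · rw [h, optWord, comapDomain_single_append, evalComb_single, sub_self]
          exact zero_mem _
        · rw [h, optWord, map_zero, map_zero, zero_sub]
          exact neg_mem ⟨y, hy.symm⟩) (nf k u)
    obtain ⟨y, hy⟩ := key
    refine ⟨y, ?_⟩
    rw [LinearMap.sub_apply, eq_sub_iff_add_eq, eval_nf, add_comm] at hy
    rw [divC, LinearMap.comp_apply, LinearMap.comp_apply, nf_mul_wordC]
    exact hy.symm

/-! ### Left annihilators of words, and the resulting vanishing of Ext. -/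

theorem appendGen_z (w : List Gen) :
    appendGen .z w = some (.z :: w) ∨ appendGen .z w = none ∧ ∃ v, w = [.z, .z, .z] ++ v := by
  unfold appendGen; split <;> simp_all

/-- If the word ends in `z`, three more factors `z` complete a `z⁴`, at the latest with the third
one. -/
theorem appendWord_zzz (w : List Gen) : appendWord [.z, .z, .z] w = some ([.z, .z, .z] ++ w) ∨
    appendWord [.z, .z, .z] w = none ∧ ∃ v, w = [.z] ++ v := by
  rcases w with _ | ⟨y, w⟩
  · exact Or.inl rfl
  by_cases hy : y = .z
  · subst hy
    refine Or.inr ⟨?_, w, rfl⟩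
    rcases appendGen_z (.z :: w) with h | ⟨h, -⟩
    · rcases appendGen_z (.z :: .z :: w) with h' | ⟨h', -⟩
      · simp only [appendWord, Option.bind_some, h, h']; rfl
      · simp only [appendWord, Option.bind_some, h, h']; rfl
    · simp only [appendWord, Option.bind_some, h]; rfl
  · left; cases y <;> first | rfl | exact absurd rfl hy

theorem exists_eq_mul_of_append {p : List Gen} {w : List Gen} (h : ∃ v, w = p ++ v) :
    ∃ v, wordC k w = v * wordC k p := by
  obtain ⟨v, rfl⟩ := h
  exact ⟨_, wordC_append k p v⟩

/-- Lists are stored backwards, so `[.b, .a]` is `ab` and `[.d, .c]` is `cd`. The factor `a` is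
obstructed only after `cd`, and the factor `b` never. -/
theorem isDivision_ab :
    IsDivision (gradingC k) (wordC k [.b, .a]) (wordC k [.d, .c]) 2 (divC k [.b, .a]) := by
  refine isDivision_divC k (p := [.b, .a]) ?_ fun w => ?_
  · have := (satisfiesRels_genC k).cda
    simp only [evalWord, one_mul, ← mul_assoc, this, zero_mul]
  · have : appendWord [.b, .a] w = some ([.b, .a] ++ w) ∨
        appendWord [.b, .a] w = none ∧ ∃ v, w = [.d, .c] ++ v := by
      rcases w with _ | ⟨y, _ | ⟨x, w⟩⟩ <;> try cases y
      all_goals try cases x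
      all_goals first | exact Or.inl rfl | exact Or.inr ⟨rfl, _, rfl⟩
    exact this.imp_right fun h => ⟨h.1, exists_eq_mul_of_append k h.2⟩

theorem isDivision_cd :
    IsDivision (gradingC k) (wordC k [.d, .c]) (wordC k [.b, .a]) 2 (divC k [.d, .c]) := by
  refine isDivision_divC k (p := [.d, .c]) ?_ fun w => ?_
  · have := (satisfiesRels_genC k).abc
    simp only [evalWord, one_mul, ← mul_assoc, this, zero_mul]
  · have : appendWord [.d, .c] w = some ([.d, .c] ++ w) ∨
        appendWord [.d, .c] w = none ∧ ∃ v, w = [.b, .a] ++ v := by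
      rcases w with _ | ⟨y, _ | ⟨x, w⟩⟩ <;> try cases y
      all_goals try cases x
      all_goals first | exact Or.inl rfl | exact Or.inr ⟨rfl, _, rfl⟩
    exact this.imp_right fun h => ⟨h.1, exists_eq_mul_of_append k h.2⟩

theorem isDivision_a :
    IsDivision (gradingC k) (wordC k [.a]) (wordC k [.d, .c]) 1 (divC k [.a]) := by
  refine isDivision_divC k (p := [.a]) ?_ fun w => ?_
  · have := (satisfiesRels_genC k).cda
    simp only [evalWord, one_mul, this]
  · have : appendWord [.a] w = some ([.a] ++ w) ∨
        appendWord [.a] w = none ∧ ∃ v, w = [.d, .c] ++ v := by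
      rcases w with _ | ⟨y, _ | ⟨x, w⟩⟩ <;> try cases y
      all_goals try cases x
      all_goals first | exact Or.inl rfl | exact Or.inr ⟨rfl, _, rfl⟩
    exact this.imp_right fun h => ⟨h.1, exists_eq_mul_of_append k h.2⟩

theorem isDivision_c :
    IsDivision (gradingC k) (wordC k [.c]) (wordC k [.b, .a]) 1 (divC k [.c]) := by
  refine isDivision_divC k (p := [.c]) ?_ fun w => ?_
  · have := (satisfiesRels_genC k).abc
    simp only [evalWord, one_mul, this]
  · have : appendWord [.c] w = some ([.c] ++ w) ∨
        appendWord [.c] w = none ∧ ∃ v, w = [.b, .a] ++ v := by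
      rcases w with _ | ⟨y, _ | ⟨x, w⟩⟩ <;> try cases y
      all_goals try cases x
      all_goals first | exact Or.inl rfl | exact Or.inr ⟨rfl, _, rfl⟩
    exact this.imp_right fun h => ⟨h.1, exists_eq_mul_of_append k h.2⟩

theorem isDivision_z :
    IsDivision (gradingC k) (wordC k [.z]) (wordC k [.z, .z, .z]) 1 (divC k [.z]) := by
  refine isDivision_divC k (p := [.z]) ?_ fun w => ?_
  · simp only [evalWord, one_mul, (satisfiesRels_genC k).zzzz]
  · exact (appendGen_z w).imp_right fun h => ⟨h.1, exists_eq_mul_of_append k h.2⟩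

theorem isDivision_zzz :
    IsDivision (gradingC k) (wordC k [.z, .z, .z]) (wordC k [.z]) 3 (divC k [.z, .z, .z]) := by
  refine isDivision_divC k (p := [.z, .z, .z]) ?_ fun w => ?_
  · simp only [evalWord, one_mul, ← mul_assoc, (satisfiesRels_genC k).zzzz]
  · exact (appendWord_zzz w).imp_right fun h => ⟨h.1, exists_eq_mul_of_append k h.2⟩

/-- No rewriting rule has a left side ending in `b`, so right multiplication by `b` is injective;
the same holds for `d`. -/
theorem isDivision_b : IsDivision (gradingC k) (wordC k [.b]) 0 1 (divC k [.b]) :=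
  isDivision_divC k (p := [.b]) (zero_mul _) fun w => Or.inl <| by
    rcases w with _ | ⟨y, w⟩ <;> [rfl; (cases y <;> rfl)]

theorem isDivision_d : IsDivision (gradingC k) (wordC k [.d]) 0 1 (divC k [.d]) :=
  isDivision_divC k (p := [.d]) (zero_mul _) fun w => Or.inl <| by
    rcases w with _ | ⟨y, w⟩ <;> [rfl; (cases y <;> rfl)]

/-- `C/Cab` and `C/Ccd` are free modulo a shifted copy of each other, and each step of this
alternation costs two internal degrees. -/
theorem acyclic_ab_cd (i : ℕ) : ∀ j : ℤ, 2 * i < j →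
    Acyclic (gradingC k) (wordC k [.b, .a]) j i ∧
      Acyclic (gradingC k) (wordC k [.d, .c]) j i := by
  induction i with
  | zero =>
    intro j hj
    exact ⟨acyclic_zero (isConnected_gradingC k) _ (by simp at hj; omega),
      acyclic_zero (isConnected_gradingC k) _ (by simp at hj; omega)⟩
  | succ i ih =>
    intro j hj
    have := ih (j - (2 : ℕ)) (by push_cast at hj ⊢; omega)
    exact ⟨acyclic_succ (isConnected_gradingC k) (isDivision_ab k) this.2,
      acyclic_succ (isConnected_gradingC k) (isDivision_cd k) this.1⟩

theorem acyclic_a_c (i : ℕ) {j : ℤ} (hj : 2 * i + 1 < j) :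
    Acyclic (gradingC k) (wordC k [.a]) j (i + 1) ∧
      Acyclic (gradingC k) (wordC k [.c]) j (i + 1) := by
  have := acyclic_ab_cd k i (j - (1 : ℕ)) (by push_cast; omega)
  exact ⟨acyclic_succ (isConnected_gradingC k) (isDivision_a k) this.2,
    acyclic_succ (isConnected_gradingC k) (isDivision_c k) this.1⟩

/-- `C/Cz` and `C/Cz³` alternate with shifts 1 and 3; this is the source of `δ₄`. The second bound
is the one that applies to the component at `z` of a form on `C₊`, where the letter `z` has used up
one internal degree. -/
theorem acyclic_z (i : ℕ) : ∀ j : ℤ,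
    ((delta 4 i : ℤ) < j → Acyclic (gradingC k) (wordC k [.z]) j i) ∧
    ((delta 4 (i + 1) : ℤ) < j + 1 → Acyclic (gradingC k) (wordC k [.z, .z, .z]) j i) := by
  induction i with
  | zero =>
    intro j
    exact ⟨fun hj => acyclic_zero (isConnected_gradingC k) _ (by simp [delta] at hj; omega),
      fun hj => acyclic_zero (isConnected_gradingC k) _ (by simp [delta] at hj; omega)⟩
  | succ i ih =>
    intro j
    refine ⟨fun hj => acyclic_succ (isConnected_gradingC k) (isDivision_z k)
        ((ih _).2 (by push_cast; omega)), fun hj =>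
      acyclic_succ (isConnected_gradingC k) (isDivision_zzz k) ((ih _).1 ?_)⟩
    -- One full round through `z` and `z³` costs `1 + 3` internal degrees.
    have : delta 4 (i + 1 + 1) = delta 4 i + 4 := by unfold delta; omega
    push_cast [this] at hj ⊢
    omega

end Division

/-! ### Gluing forms on `C₊` -/

section Glue

open ModForm

variable (k : Type u) [Field k]

/-- A family of linear forms indexed by the generators, evaluated at a word without its last
letter. -/
noncomputable def glueWord (φ : Gen → AlgC k →ₗ[k] k) : List Gen → k
  | [] => 0
  | x :: w => φ x (wordC k w)

/-- The linear form on `C` that takes the value `φ x v` at `v x`, for all generators `x`. -/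
noncomputable def glue (φ : Gen → AlgC k →ₗ[k] k) : AlgC k →ₗ[k] k :=
  Finsupp.linearCombination k (glueWord k φ) ∘ₗ nf k

theorem glue_lin (c : k) (φ ψ : Gen → AlgC k →ₗ[k] k) :
    glue k (fun x => c • φ x + ψ x) = c • glue k φ + glue k ψ := by
  have h : glueWord k (fun x => c • φ x + ψ x) = c • glueWord k φ + glueWord k ψ :=
    funext fun w => by cases w <;> simp [glueWord]
  ext u
  simp only [glue, LinearMap.comp_apply, LinearMap.add_apply, LinearMap.smul_apply, h,
    Finsupp.linearCombination_apply, Finsupp.smul_sum, ← Finsupp.sum_add]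
  refine Finsupp.sum_congr fun w _ => ?_
  simp [mul_add, mul_left_comm]

/-- The conditions under which a family of linear forms can be glued. -/
structure Glues (φ : Gen → AlgC k →ₗ[k] k) : Prop where
  bc : ∀ u, φ .c (u * genC k .b) = φ .f (u * genC k .e)
  ae : ∀ u, φ .e (u * genC k .a) = 0
  da : ∀ u, φ .a (u * genC k .d) = φ .m (u * genC k .l)
  cl : ∀ u, φ .l (u * genC k .c) = 0
  zzzz : ∀ u, φ .z (u * wordC k [.z, .z, .z]) = 0

/-- Each rewriting rule is matched by a syzygy of the letters. The derived rules need no condition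
of their own: `φ_c (u ab) = φ_f (u ae) = 0`, and `φ_a (u cd) = φ_m (u cl) = 0`. -/
theorem glueWord_appendGen {φ : Gen → AlgC k →ₗ[k] k} (h : Glues k φ) (x : Gen)
    (w : List Gen) : Finsupp.linearCombination k (glueWord k φ) (optWord k (appendGen x w)) =
      φ x (wordC k w) := by
  unfold appendGen
  split <;> simp only [optWord, map_zero, Finsupp.linearCombination_single, one_smul, glueWord,
    wordC, evalWord]
  · exact h.bc _
  · exact h.da _
  · exact (h.ae _).symm
  · exact (h.cl _).symm
  · rw [h.bc, mul_assoc, (satisfiesRels_genC k).ae, mul_zero, map_zero]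
  · rw [h.da, mul_assoc, (satisfiesRels_genC k).cl, mul_zero, map_zero]
  · have := h.zzzz
    simp only [wordC, evalWord, one_mul, ← mul_assoc] at this
    exact (this _).symm

theorem glue_mul_genC {φ : Gen → AlgC k →ₗ[k] k} (h : Glues k φ) (v : AlgC k) (x : Gen) :
    glue k φ (v * genC k x) = φ x v := by
  have : Finsupp.linearCombination k (glueWord k φ) ∘ₗ rightMul k x =
      φ x ∘ₗ evalComb k (genC k) := linearMap_ext_words k fun w => by
    rw [LinearMap.comp_apply, rightMul_single, glueWord_appendGen k h, LinearMap.comp_apply,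
      evalComb_single]
  rw [glue, LinearMap.comp_apply, nf_mul_genC]
  refine (LinearMap.congr_fun this _).trans ?_
  rw [LinearMap.comp_apply, eval_nf]

/-- The cochain glued from a family of cochains. -/
noncomputable def glueForm (h : Gen → ModForm (gradingC k)) : ModForm (gradingC k) :=
  fun w => glue k fun x => h x w

theorem glueForm_mem_coch {i : ℕ} {j : ℤ} {h : Gen → ModForm (gradingC k)}
    (hh : ∀ x, h x ∈ coch (gradingC k) i (j - 1)) : glueForm k h ∈ coch (gradingC k) i j := by
  have h0 : glue k (fun _ => 0) = 0 := by
    ext u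
    have hw : glueWord k (fun _ => 0) = 0 := funext fun w => by cases w <;> rfl
    simp [glue, hw]
  refine ⟨fun a b c x y => ?_, fun w hw => ?_, fun w ds n u hw hu h' => ?_⟩
  · simp only [glueForm, ← glue_lin]
    exact congrArg (glue k) (funext fun g => (hh g).1 a b c x y)
  · refine Eq.trans (congrArg (glue k) (funext fun g => ?_)) h0
    exact (hh g).2.1 w hw
  · rw [glueForm, glue, LinearMap.comp_apply, Finsupp.linearCombination_apply]
    refine Finset.sum_eq_zero fun v hv => ?_
    have hl : v.length = n := nf_mem k hu hv
    cases v with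
    | nil => simp [glueWord]
    | cons g v =>
      have : h g w (wordC k v) = 0 := (hh g).2.2 w ds v.length _ hw (wordC_mem k v) (by
        rw [← hl, List.length_cons] at h'
        push_cast at h' ⊢
        omega)
      simp [glueWord, this]

theorem mul_genC_mem (v : AlgC k) (x : Gen) : v * genC k x ∈ augIdeal (gradingC k) := by
  rw [mem_augIdeal, map_mul, projZero_of_mem one_ne_zero (genC_mem k x), mul_zero]

/-- Right multiplication by a generator, as a map from `C` to `C₊`. -/
noncomputable def mulGen (x : Gen) : AlgC k →ₗ[k] augIdeal (gradingC k) where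
  toFun v := ⟨v * genC k x, mul_genC_mem k v x⟩
  map_add' _ _ := Subtype.ext (add_mul _ _ _)
  map_smul' _ _ := Subtype.ext (smul_mul_assoc _ _ _)

theorem coe_mulGen (x : Gen) (v : AlgC k) : (mulGen k x v : AlgC k) = v * genC k x := rfl

theorem mulGen_mul (x : Gen) (y : augIdeal (gradingC k)) (u : AlgC k) :
    mulGen k x (y * u) = y * mulGen k x u := Subtype.ext (mul_assoc _ _ _)

theorem mem_span_mul_genC {u : AlgC k} (hu : u ∈ augIdeal (gradingC k)) :
    u ∈ Submodule.span k {y | ∃ v x, y = v * genC k x} := by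
  set S := Submodule.span k {y | ∃ v x, y = v * genC k x}
  have hS : ∀ y ∈ S, y ∈ augIdeal (gradingC k) := fun y hy => by
    induction hy using Submodule.span_induction with
    | mem y hy => obtain ⟨v, x, rfl⟩ := hy; exact mul_genC_mem k v x
    | zero => exact zero_mem _
    | add y z _ _ hy hz => exact add_mem hy hz
    | smul c y _ hy => exact (augIdeal (gradingC k)).smul_mem' c hy
  have key : ∀ v : List Gen →₀ k, ∃ y ∈ S, ∃ c : k, evalComb k (genC k) v = y + c • 1 :=
    fun v => by
    induction v using Finsupp.induction_linear with
    | zero => exact ⟨0, zero_mem _, 0, by simp⟩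
    | add v₁ v₂ h₁ h₂ =>
      obtain ⟨y₁, hy₁, c₁, h₁⟩ := h₁
      obtain ⟨y₂, hy₂, c₂, h₂⟩ := h₂
      exact ⟨y₁ + y₂, add_mem hy₁ hy₂, c₁ + c₂, by rw [map_add, h₁, h₂, add_smul]; abel⟩
    | single w c =>
      rw [evalComb, Finsupp.linearCombination_single]
      cases w with
      | nil => exact ⟨0, zero_mem _, c, by simp [evalWord]⟩
      | cons x w =>
        exact ⟨c • wordC k (x :: w), Submodule.smul_mem _ _ (Submodule.subset_span ⟨_, _, rfl⟩),
          0, by simp⟩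
  obtain ⟨y, hy, c, h⟩ := key (nf k u)
  rw [eval_nf] at h
  have h1 : c • (1 : AlgC k) = 0 := by
    have h2 := mem_augIdeal.1 hu
    rw [h, map_add, mem_augIdeal.1 (hS y hy), zero_add, projZero_smul, map_one] at h2
    exact h2
  rwa [h, h1, add_zero]

theorem eq_of_mul_genC {φ ψ : AlgC k →ₗ[k] k}
    (h : ∀ v x, φ (v * genC k x) = ψ (v * genC k x)) {u : AlgC k}
    (hu : u ∈ augIdeal (gradingC k)) : φ u = ψ u := by
  have := mem_span_mul_genC k hu
  clear hu
  induction this using Submodule.span_induction with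
  | mem y hy => obtain ⟨v, x, rfl⟩ := hy; exact h v x
  | zero => simp
  | add y y' _ _ hy hy' => rw [map_add, map_add, hy, hy']
  | smul c y _ hy => rw [map_smul, map_smul, hy]

theorem posPart_coe (u : augIdeal (gradingC k)) : posPart (gradingC k) u = u :=
  Subtype.ext (by rw [coe_posPart, mem_augIdeal.1 u.2, sub_zero])

/-- A form on `C₊` is determined by its values on words whose last letter is `v x`. -/
theorem eq_of_concat_mulGen {f g : WordFun k (augIdeal (gradingC k))}
    (hf : WordFun.IsMultilinear f) (hg : WordFun.IsMultilinear g) (h0 : f [] = g [])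
    (h : ∀ w v x, f (w ++ [mulGen k x v]) = g (w ++ [mulGen k x v])) : f = g := by
  refine ext' fun w => ?_
  obtain rfl | ⟨w, u, rfl⟩ := w.eq_nil_or_concat'
  · exact h0
  · have := eq_of_mul_genC k (φ := ofWord f hf (posPart _) w) (ψ := ofWord g hg (posPart _) w)
      (fun v x => by
        have := posPart_coe k (mulGen k x v)
        rw [coe_mulGen] at this
        rw [ofWord_apply, ofWord_apply, this, h]) u.2
    rwa [ofWord_apply, ofWord_apply, posPart_coe] at this

/-- A compatible family of cochains. -/
structure GluesForm (h : Gen → ModForm (gradingC k)) : Prop where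
  bc : (h .c).rmul (genC k .b) = (h .f).rmul (genC k .e)
  ae : (h .e).rmul (genC k .a) = 0
  da : (h .a).rmul (genC k .d) = (h .m).rmul (genC k .l)
  cl : (h .l).rmul (genC k .c) = 0
  zzzz : (h .z).rmul (wordC k [.z, .z, .z]) = 0

theorem GluesForm.rmul_glueForm {k : Type u} [Field k] {h : Gen → ModForm (gradingC k)}
    (hh : GluesForm k h) (x : Gen) : (glueForm k h).rmul (genC k x) = h x :=
  funext fun w => LinearMap.ext fun u => by
    have ap {F G : ModForm (gradingC k)} (e : F = G) (u : AlgC k) : F w u = G w u := by rw [e]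
    exact glue_mul_genC k (φ := fun x => h x w)
      ⟨ap hh.bc, ap hh.ae, ap hh.da, ap hh.cl, ap hh.zzzz⟩ u x

/-- Right multiplication by `x` commutes with `D` and turns the glued cochain into its component `h
x`, so `d` can be computed letter by letter. -/
theorem GluesForm.d_toWord_glueForm {k : Type u} [Field k] {h : Gen → ModForm (gradingC k)}
    (hh : GluesForm k h) (w : List (augIdeal (gradingC k))) (v : AlgC k) (x : Gen) :
    d (toWord (glueForm k h)) (w ++ [mulGen k x v]) = D (h x) w v := by
  rw [d_toWord, coe_mulGen, ← rmul_apply, ← D_rmul, hh.rmul_glueForm]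

end Glue

/-! ### `C` is `2`-`4`-determined -/

section Determined

open ModForm

variable (k : Type u) [Field k]

/-- The restriction of a form on `C₊` to words whose last letter is a multiple of `x`. -/
noncomputable abbrev atGen (f : WordFun k (augIdeal (gradingC k)))
    (hf : WordFun.IsMultilinear f) (x : Gen) : ModForm (gradingC k) :=
  ofWord f hf (mulGen k x)

/-- Every relation `s x = t y` in `C` forces compatibility of the components at `x` and `y`; these
are the necessary conditions that `GluesForm` collects. -/
theorem atGen_rmul {f : WordFun k (augIdeal (gradingC k))} (hf : WordFun.IsMultilinear f)
    {x y : Gen} {s t : AlgC k} (h : s * genC k x = t * genC k y) :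
    (atGen k f hf x).rmul s = (atGen k f hf y).rmul t :=
  funext fun w => LinearMap.ext fun u => by
    have : mulGen k x (u * s) = mulGen k y (u * t) :=
      Subtype.ext (by rw [coe_mulGen, coe_mulGen, mul_assoc, h, mul_assoc])
    rw [rmul_apply, rmul_apply, ofWord_apply, ofWord_apply, this]

theorem atGen_rmul_eq_zero {f : WordFun k (augIdeal (gradingC k))}
    (hf : WordFun.IsMultilinear f) {x : Gen} {s : AlgC k} (h : s * genC k x = 0) :
    (atGen k f hf x).rmul s = 0 :=
  (atGen_rmul k hf (h.trans (zero_mul (genC k x)).symm)).trans (rmul_zero _)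

theorem atGen_mem_coch {i j : ℕ} {f : WordFun k (augIdeal (gradingC k))}
    (hf : f ∈ cobar (gradingC k) (i + 1, j)) (x : Gen) :
    atGen k f hf.1 x ∈ coch (gradingC k) i (j - (1 : ℕ)) :=
  ofWord_mem_coch hf fun _ _ hu => SetLike.mul_mem_graded hu (genC_mem k x)

theorem D_atGen {f : WordFun k (augIdeal (gradingC k))} (hf : WordFun.IsMultilinear f)
    (hd : d f = 0) (x : Gen) : D (atGen k f hf x) = 0 :=
  funext fun w => LinearMap.ext fun u => by
    rw [D_ofWord (mulGen_mul k x), hd]; rfl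

theorem wordC_singleton (x : Gen) : wordC k [x] = genC k x := one_mul _

/-- Primitives of the components are found separately, subject to the five syzygies. The components
at `e`, `l`, `z` are cocycles on `C/Ca`, `C/Cc`, `C/Cz³`, where the degree bound gives vanishing.
The syzygies `b[c] - e[f]` and `d[a] - l[m]` span free modules and obstruct nothing. -/
theorem exists_gluesForm {i : ℕ} {j : ℤ} (hj : (delta 4 (i + 2) : ℤ) < j + 1)
    {g : Gen → ModForm (gradingC k)} (hg : ∀ x, g x ∈ coch (gradingC k) (i + 1) j)
    (hD : ∀ x, D (g x) = 0) (hh : GluesForm k g) :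
    ∃ h : Gen → ModForm (gradingC k), (∀ x, h x ∈ coch (gradingC k) i j) ∧
      (∀ x, D (h x) = g x) ∧ GluesForm k h := by
  have hc := isConnected_gradingC k
  have hd : (2 * (i : ℤ) + 2 : ℤ) ≤ delta 4 (i + 2) - 1 := by
    have : 2 * i + 3 ≤ delta 4 (i + 2) := by unfold delta; omega
    omega
  -- The annihilators of `b` and `d` are zero, so the error to be corrected lives on `C` itself;
  -- only without variables does its internal degree matter.
  have h0 : Acyclic (gradingC k) 0 (j - (1 : ℕ)) i := by
    cases i with
    | zero =>
      have : delta 4 (0 + 2) = 4 := rfl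
      rw [this] at hj
      exact acyclic_zero hc _ (by push_cast at hj ⊢; omega)
    | succ i => exact acyclic_of_eq_zero hc _ i
  have hac := acyclic_a_c k i (j := j) (by omega)
  have hz := (acyclic_z k (i + 1) j).2 hj
  rw [wordC_singleton, wordC_singleton] at hac
  -- The primitives at `b`, `d`, `f`, `m` are arbitrary. Those at `c` and `a` come last and are
  -- adjusted to the choices at `f` and `m`.
  obtain ⟨hb, hb1, hb2⟩ := exists_D_eq hc (hg .b) (hD _)
  obtain ⟨hd, hd1, hd2⟩ := exists_D_eq hc (hg .d) (hD _)
  obtain ⟨hf, hf1, hf2⟩ := exists_D_eq hc (hg .f) (hD _)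
  obtain ⟨hm, hm1, hm2⟩ := exists_D_eq hc (hg .m) (hD _)
  obtain ⟨he, he1, he2, he3⟩ := hac.1 _ (hg .e) (hD _) hh.ae
  obtain ⟨hl, hl1, hl2, hl3⟩ := hac.2 _ (hg .l) (hD _) hh.cl
  obtain ⟨hz, hz1, hz2, hz3⟩ := hz _ (hg .z) (hD _) hh.zzzz
  obtain ⟨hc', hc1, hc2, hc3⟩ := exists_D_eq_rmul_eq hc (isDivision_b k) h0 (hg .c) (hD _)
    (rmul_mem_coch (genC_mem k .e) hf1)
    (by rw [D_rmul, hf2, wordC_singleton, hh.bc]) (rmul_zero _)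
  obtain ⟨ha, ha1, ha2, ha3⟩ := exists_D_eq_rmul_eq hc (isDivision_d k) h0 (hg .a) (hD _)
    (rmul_mem_coch (genC_mem k .l) hm1)
    (by rw [D_rmul, hm2, wordC_singleton, hh.da]) (rmul_zero _)
  rw [wordC_singleton] at hc3 ha3
  refine ⟨fun
    | .a => ha | .b => hb | .c => hc' | .d => hd | .e => he | .f => hf | .l => hl | .m => hm
    | .z => hz, fun x => ?_, fun x => ?_, ⟨hc3, he3, ha3, hl3, hz3⟩⟩
  · cases x <;> assumption
  · cases x <;> assumption

theorem exists_d_eq_of_delta_lt {i j : ℕ} (hj : delta 4 i < j)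
    {f : WordFun k (augIdeal (gradingC k))} (hf : f ∈ cobar (gradingC k) (i, j))
    (hd : d f = 0) : ∃ b ∈ cobarAlg (gradingC k), d b = f := by
  match i with
  | 0 =>
    refine ⟨0, zero_mem _, ?_⟩
    rw [map_zero]
    refine ext' fun w => ?_
    by_cases hw : w = []
    · subst hw
      exact (hf.2.2 [] [] List.Forall₂.nil (by simp [delta] at hj ⊢; omega)).symm
    · exact (hf.2.1 w (by simpa using hw)).symm
  | 1 =>
    refine ⟨0, zero_mem _, ?_⟩
    -- For a cocycle in one variable, `u ↦ f (u x)` is a cocycle without variables, of internal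
    -- degree `j - 1 ≠ 0`.
    have hx : ∀ x, atGen k f hf.1 x = 0 := fun x =>
      acyclic_zero (isConnected_gradingC k) 0 (by simp [delta] at hj; omega) _
        (atGen_mem_coch k hf x) (D_atGen k hf.1 hd x) (rmul_zero _)
    rw [map_zero]
    refine eq_of_concat_mulGen k (zero_mem (cobar (gradingC k) (1, j))).1 hf.1
      (hf.2.1 [] (by simp)).symm fun w v x => ?_
    exact (congrArg (fun F : ModForm (gradingC k) => F w v) (hx x)).symm
  | i + 2 =>
    have hr := satisfiesRels_genC k
    -- Splitting off the final letter `x` of the last variable lowers the internal degree by one.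
    obtain ⟨h, hh, hhD, hhg⟩ := exists_gluesForm k (i := i) (j := j - (1 : ℕ)) (by push_cast; omega)
      (atGen_mem_coch k hf) (D_atGen k hf.1 hd)
      ⟨atGen_rmul k hf.1 hr.bc, atGen_rmul_eq_zero k hf.1 hr.ae, atGen_rmul k hf.1 hr.da,
        atGen_rmul_eq_zero k hf.1 hr.cl, atGen_rmul_eq_zero k hf.1 (by
          simpa only [wordC, evalWord, one_mul] using hr.zzzz)⟩
    have hm : toWord (glueForm k h) ∈ cobar (gradingC k) (i + 1, j) :=
      toWord_mem_cobar (glueForm_mem_coch k hh)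
    refine ⟨_, mem_cobarAlg _ hm, ?_⟩
    refine eq_of_concat_mulGen k hm.1.d hf.1 (hf.2.1 [] (by simp)).symm fun w v x => ?_
    rw [hhg.d_toWord_glueForm, hhD]
    rfl

theorem extComp_eq_bot {i j : ℕ} (hj : delta 4 i < j) : extComp (gradingC k) i j = ⊥ := by
  rw [eq_bot_iff]
  rintro _ ⟨z, hz, rfl⟩
  rw [Submodule.mem_bot]
  obtain ⟨b, hb, h⟩ := exists_d_eq_of_delta_lt k hj (f := z) hz z.2.2
  exact Ideal.Quotient.eq_zero_iff_mem.2 ⟨b, hb, h⟩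

/-! ### The presentation of `C` by relations of degrees 2 and 4. -/

/-- The free algebra on `Fin 9` maps to the free algebra on the generators of `C`. -/
noncomputable def renameGen : FreeAlgebra k (Fin 9) →ₐ[k] FreeAlgebra k Gen :=
  FreeAlgebra.lift k fun i => FreeAlgebra.ι k (finEquivGen i)

theorem renameGen_surjective : Function.Surjective (renameGen k) := fun p => by
  have : (renameGen k).comp (FreeAlgebra.lift k fun x => FreeAlgebra.ι k (finEquivGen.symm x)) =
      AlgHom.id k _ := FreeAlgebra.hom_ext (funext fun x => by simp [renameGen])
  exact ⟨_, DFunLike.congr_fun this p⟩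

theorem ι_mul_ι_mem_freePart {X : Type*} (x y : X) :
    FreeAlgebra.ι k x * FreeAlgebra.ι k y ∈ freePart k X 2 := by
  rw [freePart, pow_two]
  exact Submodule.mul_mem_mul (Submodule.subset_span ⟨x, rfl⟩) (Submodule.subset_span ⟨y, rfl⟩)

/-- The quotient of the free algebra by the ideal that `S` generates satisfies the relations of `C`,
since these have degrees 2 and 4. So normal forms can be evaluated in it; an element of the kernel
has normal form zero and hence vanishes in this quotient. -/
theorem ker_projC_renameGen :
    TwoSidedIdeal.ker ((projC k).comp (renameGen k)) = TwoSidedIdeal.span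
      {p | (projC k).comp (renameGen k) p = 0 ∧
        (p ∈ freePart k (Fin 9) 2 ∨ p ∈ freePart k (Fin 9) 4)} := by
  set S := {p | (projC k).comp (renameGen k) p = 0 ∧
        (p ∈ freePart k (Fin 9) 2 ∨ p ∈ freePart k (Fin 9) 4)} with hS
  refine le_antisymm (fun p hp => ?_) (TwoSidedIdeal.span_le.2 fun p hp => ?_)
  · let q : FreeAlgebra k (Fin 9) →ₐ[k] (TwoSidedIdeal.span S).ringCon.Quotient :=
      RingCon.mkₐ k _
    have hq : ∀ {p}, q p = 0 ↔ p ∈ TwoSidedIdeal.span S := fun {p} => by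
      rw [TwoSidedIdeal.mem_iff]
      exact RingCon.eq _
    let Φ : Gen → (TwoSidedIdeal.span S).ringCon.Quotient :=
      fun x => q (FreeAlgebra.ι k (finEquivGen.symm x))
    have hι : ∀ x, projC k (renameGen k (FreeAlgebra.ι k (finEquivGen.symm x))) = genC k x :=
      fun x => by simp [projC, renameGen]
    have hr := satisfiesRels_genC k
    have hΦ : SatisfiesRels Φ := by
      constructor <;> simp only [Φ, ← map_mul]
      · rw [← sub_eq_zero, ← map_sub, hq]
        exact TwoSidedIdeal.subset_span ⟨by simp [hι, hr.bc],
          Or.inl (sub_mem (ι_mul_ι_mem_freePart k _ _) (ι_mul_ι_mem_freePart k _ _))⟩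
      · rw [hq]
        exact TwoSidedIdeal.subset_span ⟨by simp [hι, hr.ae], Or.inl (ι_mul_ι_mem_freePart k _ _)⟩
      · rw [← sub_eq_zero, ← map_sub, hq]
        exact TwoSidedIdeal.subset_span ⟨by simp [hι, hr.da],
          Or.inl (sub_mem (ι_mul_ι_mem_freePart k _ _) (ι_mul_ι_mem_freePart k _ _))⟩
      · rw [hq]
        exact TwoSidedIdeal.subset_span ⟨by simp [hι, hr.cl], Or.inl (ι_mul_ι_mem_freePart k _ _)⟩
      · rw [hq]
        refine TwoSidedIdeal.subset_span ⟨by simp [hι, hr.zzzz], Or.inr ?_⟩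
        have h := Submodule.mul_mem_mul (ι_mul_ι_mem_freePart k (finEquivGen.symm .z)
          (finEquivGen.symm .z)) (ι_mul_ι_mem_freePart k (finEquivGen.symm .z)
          (finEquivGen.symm .z))
        rwa [freePart, ← pow_add, ← mul_assoc] at h
    have hlift : (FreeAlgebra.lift k Φ).comp (renameGen k) = q :=
      FreeAlgebra.hom_ext (funext fun i => by simp [renameGen, Φ])
    rw [TwoSidedIdeal.mem_ker] at hp
    -- Acting on the empty word gives the normal form, whose value in the quotient is the class of
    -- `p`.
    have h := evalComb_freeAct hΦ (renameGen k p) (Finsupp.single [] 1)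
    rw [← nf_projC, evalComb_single, evalWord, one_mul] at h
    change projC k (renameGen k p) = 0 at hp
    rw [hp, map_zero, map_zero] at h
    rw [← hq, ← hlift]
    exact h.symm
  · exact (TwoSidedIdeal.mem_ker _).2 hp.1

theorem isTwoDetermined_gradingC : IsTwoDetermined (gradingC k) 4 where
  two_lt := by norm_num
  presentation := ⟨9, (projC k).comp (renameGen k),
    (projC_surjective k).comp (renameGen_surjective k),
    fun x => by simpa [projC, renameGen] using genC_mem k (finEquivGen x),
    ker_projC_renameGen k⟩
  bidegrees i j h := by
    by_contra hj
    exact h (extComp_eq_bot k (not_le.1 hj))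

end Determined

/-! ### Evaluation of cocycles at words with vanishing products -/

section Evaluation

variable {k : Type u} [Field k] {N : Type v}

theorem mul_eq_of_prefixes (w : List N) : ∀ f g : WordFun k N,
    (∀ a b, a ++ b = w → b ≠ [] → f a = 0) → (f * g) w = f w * g [] := by
  induction w with
  | nil => intro f g _; rfl
  | cons x w ih =>
    intro f g h
    rw [mul_cons, h [] (x :: w) rfl (List.cons_ne_nil _ _), zero_mul, zero_add]
    exact ih _ _ fun a b hab hb => h (x :: a) b (by simp [hab]) hb

/-- If `f` vanishes on all proper nonempty prefixes of `w`, then evaluation at `w` is a derivation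
at `f`. -/
theorem mul_eq_of_proper_prefixes {w : List N} (hw : w ≠ []) (f g : WordFun k N)
    (h : ∀ a b, a ++ b = w → a ≠ [] → b ≠ [] → f a = 0) :
    (f * g) w = f [] * g w + f w * g [] := by
  cases w with
  | nil => exact absurd rfl hw
  | cons x w =>
    rw [mul_cons, mul_eq_of_prefixes w (f.tail x) g fun a b hab hb =>
      h (x :: a) b (by simp [hab]) (List.cons_ne_nil _ _) hb]
    rfl

/-- Partial evaluation at an initial word. -/
def tails (f : WordFun k N) (p : List N) : WordFun k N := fun v => f (p ++ v)

theorem tails_ap (f : WordFun k N) (p v : List N) : tails f p v = f (p ++ v) := rfl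

variable [NonUnitalRing N] [Module k N]

theorem IsMultilinear.apply_zero {f : WordFun k N} (hf : IsMultilinear f) (a b : List N) :
    f (a ++ 0 :: b) = 0 := (hf a b).map_zero

/-- The differential only sees the end of a word whose other adjacent products vanish. -/
theorem d_append (p : List N) (x : N) (r : List N) : ∀ {f : WordFun k N} (_ : IsMultilinear f)
    (_ : (p ++ [x]).IsChain fun y z => y * z = 0),
      d f (p ++ x :: r) = (-1) ^ p.length * d (tails f p) (x :: r) := by
  induction p with
  | nil => intro f _ _; simp only [List.nil_append, List.length_nil, pow_zero, one_mul]; rfl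
  | cons y p ih =>
    intro f hf hc
    have hc' : (p ++ [x]).IsChain fun y z => y * z = 0 := hc.tail
    have h := ih (hf.tail y) hc'
    obtain ⟨z, v, e, hz⟩ : ∃ z v, p ++ x :: r = z :: v ∧ y * z = 0 := by
      cases p with
      | nil => exact ⟨x, r, rfl, by simpa using hc⟩
      | cons z p =>
        refine ⟨z, p ++ x :: r, rfl, ?_⟩
        simp only [List.cons_append] at hc
        exact (List.isChain_cons_cons.1 hc).1
    have h0 : f (0 :: v) = 0 := IsMultilinear.apply_zero hf [] v
    have ht : tails (f.tail y) p = tails f (y :: p) := rfl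
    -- The first merge yields the letter `0`, where a multilinear form vanishes; only the recursive
    -- term remains.
    rw [List.cons_append, e, d_cons, hz, ← e, h, h0, List.length_cons, pow_succ, ht]
    ring

/-- A cocycle vanishes on `p, x y` if the products in `p, x` vanish. -/
theorem cocycle_concat_mul {f : WordFun k N} (hf : IsMultilinear f) (hd : d f = 0) {p : List N}
    {x : N} (hp : (p ++ [x]).IsChain fun y z => y * z = 0) (y : N) : f (p ++ [x * y]) = 0 := by
  have h := d_append p x [y] hf hp
  rw [hd, zero_ap, d_cons, d_single, sub_zero, tails_ap] at h
  exact ((mul_eq_zero.1 h.symm).resolve_left (pow_ne_zero _ (neg_ne_zero.2 one_ne_zero)))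

/-- If `x y = u v` and the products in `p, c, u` vanish, then a cocycle vanishes on
`p, c x, y`. -/
theorem cocycle_concat_mul_mul {f : WordFun k N} (hf : IsMultilinear f) (hd : d f = 0)
    {p : List N} {c x y u v : N} (hp : (p ++ [c]).IsChain fun y z => y * z = 0)
    (hcu : c * u = 0) (h : x * y = u * v) : f (p ++ [c * x, y]) = 0 := by
  have h1 := d_append p c [x, y] hf hp
  rw [hd, zero_ap, d_cons, d_cons, d_single, sub_zero, tail_ap, h, tails_ap, tails_ap] at h1
  have h2 : f (p ++ [c, u * v]) = 0 := by
    have := cocycle_concat_mul hf hd (p := p ++ [c]) (x := u) (List.isChain_append.2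
      ⟨hp, List.isChain_singleton _, fun a ha b hb => by
        simp at ha hb
        rw [← ha, ← hb, hcu]⟩) v
    simpa using this
  have h3 := (mul_eq_zero.1 h1.symm).resolve_left (pow_ne_zero _ (neg_ne_zero.2 one_ne_zero))
  rw [h2, sub_zero] at h3
  exact h3

end Evaluation

/-! ### The Yoneda algebra of `C` is not finitely generated -/

section NotFinite

open ModForm

variable (k : Type u) [Field k]

/-- The generators of `C` as elements of `C₊`. -/
noncomputable def genP (x : Gen) : augIdeal (gradingC k) := mulGen k x 1

theorem coe_genP (x : Gen) : (genP k x : AlgC k) = genC k x := one_mul _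

/-- The letters `cd` and `ab`, alternately. -/
noncomputable def pairLetter (n : ℕ) : augIdeal (gradingC k) :=
  if Even n then genP k .c * genP k .d else genP k .a * genP k .b

/-- The word `cd, ab, cd, …` with `n` letters. -/
noncomputable def pairWord (n : ℕ) : List (augIdeal (gradingC k)) :=
  (List.range n).map (pairLetter k)

theorem pairWord_succ (n : ℕ) : pairWord k (n + 1) = pairWord k n ++ [pairLetter k n] := by
  simp [pairWord, List.range_succ]

theorem satisfiesRels_genP : SatisfiesRels fun x => (genP k x : AlgC k) := by
  simp only [coe_genP]; exact satisfiesRels_genC k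

/-- The first letter of the `n`-th pair. -/
noncomputable def pairFst (n : ℕ) : augIdeal (gradingC k) :=
  if Even n then genP k .c else genP k .a

theorem pairLetter_mul_pairFst (n : ℕ) : pairLetter k n * pairFst k (n + 1) = 0 := by
  have h := satisfiesRels_genP k
  refine Subtype.ext ?_
  by_cases hn : Even n
  · simpa [pairLetter, pairFst, hn, Nat.even_add_one] using h.cda
  · simpa [pairLetter, pairFst, hn, Nat.even_add_one] using h.abc

theorem exists_pairLetter_eq (n : ℕ) : ∃ y, pairLetter k n = pairFst k n * y := by
  unfold pairLetter pairFst
  split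
  · exact ⟨_, rfl⟩
  · exact ⟨_, rfl⟩

theorem isChain_pairWord (n : ℕ) {y : augIdeal (gradingC k)}
    (hy : ∀ m, n = m + 1 → pairLetter k m * y = 0) :
    (pairWord k n ++ [y]).IsChain fun y z => y * z = 0 := by
  induction n generalizing y with
  | zero => exact List.isChain_singleton _
  | succ n ih =>
    rw [pairWord_succ]
    refine List.isChain_append.2 ⟨ih fun m hm => ?_, List.isChain_singleton _, fun a ha b hb => ?_⟩
    · subst hm
      obtain ⟨z, hz⟩ := exists_pairLetter_eq k (m + 1)
      rw [hz, ← mul_assoc, pairLetter_mul_pairFst, zero_mul]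
    · simp at ha hb
      rw [← ha, ← hb, hy n rfl]

theorem isChain_pairWord_pairFst (n : ℕ) :
    (pairWord k n ++ [pairFst k n]).IsChain fun y z => y * z = 0 :=
  isChain_pairWord k n fun m hm => by rw [hm, pairLetter_mul_pairFst]

/-- The word `cd, ab, …, cd, a, e`, with `2 n + 3` letters. -/
noncomputable def testWord (n : ℕ) : List (augIdeal (gradingC k)) :=
  pairWord k (2 * n + 1) ++ [genP k .a, genP k .e]

/-- Split the last pair `x y` into two letters. In the longer word all products but `x y` vanish, so
the cocycle condition there is, up to sign, the claim. -/
theorem cocycle_pairWord {f : WordFun k (augIdeal (gradingC k))}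
    (hf : WordFun.IsMultilinear f) (hd : d f = 0) (n : ℕ) : f (pairWord k (n + 1)) = 0 := by
  obtain ⟨y, hy⟩ := exists_pairLetter_eq k n
  rw [pairWord_succ, hy]
  exact cocycle_concat_mul hf hd (isChain_pairWord_pairFst k n) y

/-- Splitting the end `cd, a` into `c, d, a` leaves two terms, ending in `cd, a` and in `c, da`.
Since `da = lm` and `cl = 0`, the second vanishes by the preceding kind of argument. Here the
rewriting of `da` is essential. -/
theorem cocycle_pairWord_a {f : WordFun k (augIdeal (gradingC k))}
    (hf : WordFun.IsMultilinear f) (hd : d f = 0) (n : ℕ) :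
    f (pairWord k (2 * n + 1) ++ [genP k .a]) = 0 := by
  have h := satisfiesRels_genP k
  have hc := isChain_pairWord_pairFst k (2 * n)
  have e1 : pairFst k (2 * n) = genP k .c := by simp [pairFst]
  have e2 : pairLetter k (2 * n) = genP k .c * genP k .d := by simp [pairLetter]
  rw [e1] at hc
  rw [pairWord_succ, e2, List.append_assoc]
  exact cocycle_concat_mul_mul hf hd hc (u := genP k .l) (v := genP k .m) (Subtype.ext h.cl)
    (Subtype.ext h.da)

theorem isChain_testWord (n : ℕ) : (testWord k n).IsChain fun y z => y * z = 0 := by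
  have h := satisfiesRels_genP k
  have : testWord k n = (pairWord k (2 * n + 1) ++ [genP k .a]) ++ [genP k .e] := by
    simp [testWord]
  rw [this]
  refine List.isChain_append.2 ⟨isChain_pairWord k _ fun m hm => ?_, List.isChain_singleton _,
    fun a ha b hb => ?_⟩
  · obtain rfl : m = 2 * n := by omega
    refine Subtype.ext ?_
    simpa [pairLetter] using h.cda
  · simp at ha hb
    rw [← ha, ← hb]
    exact Subtype.ext h.ae

/-- A proper nonempty prefix either consists of pairs only or lacks just the final `e`. -/
theorem cocycle_testWord_of_append {f : WordFun k (augIdeal (gradingC k))}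
    (hf : WordFun.IsMultilinear f) (hd : d f = 0) (n : ℕ) {a b : List (augIdeal (gradingC k))}
    (hab : a ++ b = testWord k n) (ha : a ≠ []) (hb : b ≠ []) : f a = 0 := by
  have hlen := congrArg List.length hab
  have hla := List.length_pos_iff.2 ha
  have hlb := List.length_pos_iff.2 hb
  have hta : a = (testWord k n).take a.length := by rw [← hab]; simp
  simp only [testWord, pairWord, List.length_append, List.length_map, List.length_range,
    List.length_cons, List.length_nil] at hlen
  obtain ⟨m, hm⟩ : ∃ m, a.length = m + 1 := ⟨a.length - 1, by omega⟩
  rw [hm] at hta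
  by_cases hmn : m < 2 * n + 1
  · have : (testWord k n).take (m + 1) = pairWord k (m + 1) := by
      rw [testWord, List.take_append_of_le_length (by simp [pairWord]; omega), pairWord,
        ← List.map_take, List.take_range, min_eq_left (by omega), pairWord]
    rw [hta, this]
    exact cocycle_pairWord k hf hd m
  · obtain rfl : m = 2 * n + 1 := by omega
    have : (testWord k n).take (2 * n + 1 + 1) = pairWord k (2 * n + 1) ++ [genP k .a] := by
      have hl : (pairWord k (2 * n + 1)).length = 2 * n + 1 := by simp [pairWord]
      rw [testWord, List.take_append, hl, List.take_of_length_le (by omega)]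
      simp
    rw [hta, this]
    exact cocycle_pairWord_a k hf hd n

/-- Every merge of neighbours in the test word produces the letter `0`. -/
theorem coboundary_testWord {b : WordFun k (augIdeal (gradingC k))}
    (hb : WordFun.IsMultilinear b) (n : ℕ) : d b (testWord k n) = 0 := by
  refine d_eq_zero_of_merges _ _ fun p x y q h => ?_
  have hc := isChain_testWord k n
  rw [h] at hc
  have hxy : x * y = 0 := (List.isChain_append_cons_cons.1 hc).2.1
  rw [hxy]
  exact IsMultilinear.apply_zero hb p q

/-! #### A cocycle that does not vanish on the test word -/

/-- The coefficient of the empty word. -/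
noncomputable def augForm : ModForm (gradingC k)
  | [] => Finsupp.lapply [] ∘ₗ nf k
  | _ :: _ => 0

theorem nf_apply_nil {u : AlgC k} (hu : u ∈ augIdeal (gradingC k)) : nf k u [] = 0 := by
  refine eq_of_mul_genC k (φ := Finsupp.lapply [] ∘ₗ nf k) (ψ := 0) (fun v x => ?_) hu
  have : (Finsupp.lapply [] : (List Gen →₀ k) →ₗ[k] k) ∘ₗ rightMul k x = 0 :=
    linearMap_ext_words k fun w => by
      rw [LinearMap.comp_apply, rightMul_single]
      cases h : appendGen x w with
      | none => rfl
      | some y =>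
        have hy : y ≠ [] := fun hy => by
          have := length_appendGen h
          rw [hy] at this
          simp at this
        simp [optWord, hy]
  rw [LinearMap.comp_apply, nf_mul_genC]
  exact LinearMap.congr_fun this _

theorem augForm_mem_coch : augForm k ∈ coch (gradingC k) 0 0 := by
  refine ⟨fun a b c x y => ?_, fun w hw => ?_, fun w ds n u hw hu h' => ?_⟩
  · cases a <;> simp [augForm]
  · cases w with
    | nil => exact absurd rfl hw
    | cons x w => rfl
  · cases hw with
    | nil =>
      have hn : n ≠ 0 := by rintro rfl; exact h' rfl
      exact nf_apply_nil k (mem_augIdeal.2 (projZero_of_mem hn hu))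
    | cons _ _ => rfl

theorem D_augForm : D (augForm k) = 0 := funext fun w => LinearMap.ext fun u => by
  refine D_eq_zero_of_merges w u _ (fun a x y b _ => ?_) fun a x _ => ?_
  · cases a <;> rfl
  · cases a with
    | nil =>
      exact nf_apply_nil k (by rw [mem_augIdeal, map_mul, mem_augIdeal.1 x.2, zero_mul])
    | cons y a => rfl

theorem augForm_rmul {t : AlgC k} (ht : t ∈ augIdeal (gradingC k)) : (augForm k).rmul t = 0 :=
  funext fun w => LinearMap.ext fun u => by
    cases w with
    | nil =>
      rw [rmul_apply]
      exact nf_apply_nil k (by rw [mem_augIdeal, map_mul, mem_augIdeal.1 ht, mul_zero])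
    | cons x w => rfl

theorem divC_one {x : Gen} {p : List Gen} : divC k (x :: p) 1 = 0 := by
  rw [divC, LinearMap.comp_apply, LinearMap.comp_apply, nf_one]
  convert map_zero (evalComb k (genC k))
  ext w
  exact Finsupp.single_eq_of_ne (by simp)

/-- One step of the construction: a cocycle that vanishes on `C t'` yields a cocycle that vanishes
on `C t`, with known values at words ending in `t`. -/
theorem exists_cocycle_step {x : Gen} {p : List Gen} {t' : AlgC k} {s : ℕ}
    (hσ : IsDivision (gradingC k) (wordC k (x :: p)) t' s (divC k (x :: p)))
    (hw : appendWord (x :: p) [] = some (x :: p))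
    {i : ℕ} {j : ℤ} {F : ModForm (gradingC k)} (hF : F ∈ coch (gradingC k) i j)
    (hD : D F = 0) (ht : F.rmul t' = 0) (t : augIdeal (gradingC k))
    (htc : (t : AlgC k) = wordC k (x :: p)) :
    ∃ G ∈ coch (gradingC k) (i + 1) (j + s), D G = 0 ∧ G.rmul (wordC k (x :: p)) = 0 ∧
      ∀ w, w.length = i → G (w ++ [t]) 1 = (-1) ^ i * F w 1 := by
  have hm : F.comp (divC k (x :: p)) ∈ coch (gradingC k) i (j + s) := by
    have := comp_mem_coch hσ.shift hF
    rwa [sub_neg_eq_add] at this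
  refine ⟨D (F.comp (divC k (x :: p))), D_mem_coch hm, D_D _, ?_, fun w hwl => ?_⟩
  · rw [← D_rmul, comp_rmul_of_isDivision hσ ht, hD]
  · have hdiv : divC k (x :: p) t = 1 := by
      rw [htc, divC, LinearMap.comp_apply, LinearMap.comp_apply, ← one_mul (wordC k (x :: p)),
        nf_mul_wordC, nf_one, Finsupp.linearCombination_single, one_smul, hw, optWord]
      have := comapDomain_single_append k (x :: p) []
      rw [List.append_nil] at this
      rw [this, evalComb_single]
      rfl
    -- Terms of the differential that leave the coefficient at `1` vanish because `1` is not
    -- divisible by a nonempty word. Only the term that absorbs `t` into the coefficient survives,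
    -- and division turns `t` into `1`.
    have key : ∀ (w : List (augIdeal (gradingC k))) (F : ModForm (gradingC k)),
        D (F.comp (divC k (x :: p))) (w ++ [t]) 1 = (-1) ^ w.length * F w 1 := by
      intro w
      induction w with
      | nil =>
        intro F
        rw [List.nil_append, D_single, comp_apply, mul_one, hdiv]
        simp
      | cons y w ih =>
        intro F
        have h := ih (F.tail y)
        have e : (F.comp (divC k (x :: p))).tail y = (F.tail y).comp (divC k (x :: p)) := rfl
        obtain ⟨z, v, hz⟩ : ∃ z v, w ++ [t] = z :: v := by cases w <;> exact ⟨_, _, rfl⟩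
        rw [List.cons_append, hz, D_cons, LinearMap.sub_apply, comp_apply, divC_one, map_zero, e,
          ← hz, h, List.length_cons, pow_succ, ModForm.tail]
        ring
    rw [key, hwl]

/-- The letters `cd` and `ab`, alternately, as words. -/
def pairList (n : ℕ) : List Gen := if Even n then [.d, .c] else [.b, .a]

theorem coe_pairLetter (n : ℕ) : (pairLetter k n : AlgC k) = wordC k (pairList n) := by
  unfold pairLetter pairList
  split <;> simp [evalWord, coe_genP]

theorem length_pairWord (n : ℕ) : (pairWord k n).length = n := by simp [pairWord]

/-- The construction alternates between division by `cd` and by `ab`. Vanishing on multiples of the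
next pair is carried along because it is what the next step requires. -/
theorem exists_cocycle_pairWord (n : ℕ) : ∃ F ∈ coch (gradingC k) n (2 * n), D F = 0 ∧
    F.rmul (wordC k (pairList (n + 1))) = 0 ∧ F (pairWord k n) 1 ≠ 0 := by
  induction n with
  | zero =>
    refine ⟨augForm k, augForm_mem_coch k, D_augForm k, augForm_rmul k ?_, ?_⟩
    · rw [← coe_pairLetter]; exact (pairLetter k _).2
    · change nf k 1 [] ≠ 0
      rw [nf_one]; simp
  | succ n ih =>
    obtain ⟨F, hF, hD, ht, hw⟩ := ih
    have hl := length_pairWord k n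
    have hs : (2 * ((n + 1 : ℕ) : ℤ)) = 2 * n + (2 : ℕ) := by push_cast; ring
    have he : pairList (n + 1 + 1) = pairList n := by simp [pairList, Nat.even_add_one]
    rw [pairWord_succ, he, hs]
    have hc := coe_pairLetter k n
    by_cases hn : Even n
    · have e1 : pairList n = [.d, .c] := by simp [pairList, hn]
      have e2 : pairList (n + 1) = [.b, .a] := by simp [pairList, hn, Nat.even_add_one]
      rw [e2] at ht
      rw [e1] at hc ⊢
      obtain ⟨G, hG, hGD, hGt, hGw⟩ :=
        exists_cocycle_step k (isDivision_cd k) rfl hF hD ht (pairLetter k n) hc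
      refine ⟨G, hG, hGD, hGt, ?_⟩
      rw [hGw _ hl]
      exact mul_ne_zero (pow_ne_zero _ (neg_ne_zero.2 one_ne_zero)) hw
    · have e1 : pairList n = [.b, .a] := by simp [pairList, hn]
      have e2 : pairList (n + 1) = [.d, .c] := by simp [pairList, hn, Nat.even_add_one]
      rw [e2] at ht
      rw [e1] at hc ⊢
      obtain ⟨G, hG, hGD, hGt, hGw⟩ :=
        exists_cocycle_step k (isDivision_ab k) rfl hF hD ht (pairLetter k n) hc
      refine ⟨G, hG, hGD, hGt, ?_⟩
      rw [hGw _ hl]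
      exact mul_ne_zero (pow_ne_zero _ (neg_ne_zero.2 one_ne_zero)) hw

/-- After an odd number of pairs the cocycle vanishes on `C cd`, the annihilator of `a`. One more
step yields a cocycle that vanishes on `C a`, which can be placed at the letter `e` because `ae =
0`. -/
theorem exists_cocycle_testWord (n : ℕ) :
    ∃ f ∈ cocycles (gradingC k), f (testWord k n) ≠ 0 := by
  obtain ⟨F, hF, hD, ht, hw⟩ := exists_cocycle_pairWord k (2 * n + 1)
  have e : pairList (2 * n + 1 + 1) = [.d, .c] := by simp [pairList, Nat.even_add_one]
  rw [e] at ht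
  obtain ⟨G, hG, hGD, hGt, hGw⟩ := exists_cocycle_step k (isDivision_a k) rfl hF hD ht
    (genP k .a) (by rw [coe_genP, wordC_singleton])
  rw [wordC_singleton] at hGt
  have hGv := hGw _ (length_pairWord k _)
  let h : Gen → ModForm (gradingC k) := fun
    | .e => G
    | _ => 0
  -- Only the syzygy `a[e]` involves the component at `e`; all other components are zero.
  have hh : GluesForm k h := ⟨rfl, hGt, rfl, rfl, rfl⟩
  have hm : ∀ x, h x ∈ coch (gradingC k) (2 * n + 1 + 1) ((4 * n + 4 : ℕ) - 1) := fun x => by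
    have hG' : G ∈ coch (gradingC k) (2 * n + 1 + 1) ((4 * n + 4 : ℕ) - 1) := by
      -- The `2n + 1` pairs contribute 2 each and `a` contributes 1; the final `e` accounts for the
      -- `1` that is subtracted.
      have e : ((4 * n + 4 : ℕ) - 1 : ℤ) = 2 * (2 * n + 1 : ℕ) + (1 : ℕ) := by push_cast; ring
      rw [e]; exact hG
    cases x <;> first | exact hG' | exact zero_mem _
  have hcb := toWord_mem_cobar (glueForm_mem_coch k hm)
  have hDx : ∀ x, D (h x) = 0 := fun x => by
    cases x <;> first | exact hGD | exact map_zero _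
  refine ⟨toWord (glueForm k h), ⟨mem_cobarAlg _ hcb, ?_⟩, ?_⟩
  · refine eq_of_concat_mulGen k hcb.1.d (zero_mem (cobar (gradingC k) (0, 0))).1 rfl
      fun w v x => ?_
    rw [hh.d_toWord_glueForm, hDx]
    rfl
  · have e : testWord k n = (pairWord k (2 * n + 1) ++ [genP k .a]) ++ [genP k .e] := by
      simp [testWord]
    rw [e, toWord_concat, coe_genP, ← one_mul (genC k .e), ← rmul_apply, hh.rmul_glueForm]
    change G _ 1 ≠ 0
    rw [hGv]
    exact mul_ne_zero (pow_ne_zero _ (neg_ne_zero.2 one_ne_zero)) hw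

/-! #### Conclusion -/

theorem isMultilinear_of_mem_cobarAlg {f : WordFun k (augIdeal (gradingC k))}
    (hf : f ∈ cobarAlg (gradingC k)) : WordFun.IsMultilinear f :=
  cobarAlg_induction (gradingC k) (P := WordFun.IsMultilinear)
    (zero_mem (cobar (gradingC k) (0, 0))).1 (fun _ _ h => h.1)
    (fun f g hf hg => isMultilinear_iff.2 fun a b c x y => by
      rw [add_ap, add_ap, add_ap, isMultilinear_iff.1 hf, isMultilinear_iff.1 hg]; ring) hf

theorem exists_length_bound {f : WordFun k (augIdeal (gradingC k))}
    (hf : f ∈ cobarAlg (gradingC k)) : ∃ n, ∀ w, n < w.length → f w = 0 :=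
  cobarAlg_induction (gradingC k) (P := fun f => ∃ n, ∀ w, n < w.length → f w = 0)
    ⟨0, fun _ _ => rfl⟩ (fun p _ h => ⟨p.1, fun w hw => h.2.1 w (by omega)⟩)
    (fun f g ⟨m, hm⟩ ⟨n, hn⟩ => ⟨max m n, fun w hw => by
      rw [add_ap, hm w (lt_of_le_of_lt (le_max_left _ _) hw),
        hn w (lt_of_le_of_lt (le_max_right _ _) hw), add_zero]⟩) hf

theorem length_testWord (n : ℕ) : (testWord k n).length = 2 * n + 3 := by
  simp [testWord, pairWord]

/-- The cocycles that vanish on the test word form a subalgebra. -/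
noncomputable def vanishing (n : ℕ) : Subalgebra k (cocycles (gradingC k)) where
  carrier := {f | (f : WordFun k (augIdeal (gradingC k))) (testWord k n) = 0}
  add_mem' {f g} hf hg := by
    change (f : WordFun k (augIdeal (gradingC k))) _ +
      (g : WordFun k (augIdeal (gradingC k))) _ = 0
    rw [hf, hg, add_zero]
  mul_mem' {f g} hf hg := by
    change ((f : WordFun k (augIdeal (gradingC k))) *
      (g : WordFun k (augIdeal (gradingC k)))) _ = 0
    -- Evaluation at the test word is a derivation over `f ↦ f []`, so products of cocycles that
    -- vanish there vanish there.
    rw [mul_eq_of_proper_prefixes (by simp [testWord]) _ _ fun a b hab ha hb =>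
      cocycle_testWord_of_append k (isMultilinear_of_mem_cobarAlg k f.2.1) f.2.2 n hab ha hb,
      hf, hg, mul_zero, zero_mul, add_zero]
  algebraMap_mem' c := by
    change (algebraMap k (WordFun k (augIdeal (gradingC k))) c) (testWord k n) = 0
    rw [Algebra.algebraMap_eq_smul_one, smul_ap]
    cases h : testWord k n with
    | nil => simp [testWord] at h
    | cons x w => rw [one_cons, mul_zero]

theorem mem_vanishing {n : ℕ} {f : cocycles (gradingC k)} :
    f ∈ vanishing k n ↔ (f : WordFun k (augIdeal (gradingC k))) (testWord k n) = 0 := Iff.rfl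

theorem coboundaries_le_vanishing {n : ℕ} {f : cocycles (gradingC k)}
    (hf : f ∈ coboundaries (gradingC k)) : f ∈ vanishing k n := by
  obtain ⟨b, hb, h⟩ := hf
  rw [mem_vanishing, ← h]
  exact coboundary_testWord k (isMultilinear_of_mem_cobarAlg k hb) n

/-- Representatives of finitely many generators have bounded arity, so all of them vanish on a
sufficiently long test word. Then so does every cocycle, because coboundaries vanish there too. -/
theorem not_finiteType_extAlg : ¬ Algebra.FiniteType k (ExtAlg (gradingC k)) := by
  rintro ⟨S, hS⟩
  let q := Ideal.Quotient.mkₐ k (coboundaries (gradingC k))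
  have hq : Function.Surjective q := Ideal.Quotient.mk_surjective
  choose r hr using hq
  have hb : ∃ N, ∀ s ∈ S, ∀ w, N < w.length →
      (r s : WordFun k (augIdeal (gradingC k))) w = 0 := by
    choose N hN using fun s => exists_length_bound k (r s).2.1
    exact ⟨S.sup N, fun s hs w hw => hN s w (lt_of_le_of_lt (Finset.le_sup hs) hw)⟩
  obtain ⟨N, hN⟩ := hb
  -- The test word with index `N` has `2N + 3 > N` letters, beyond the arities of all chosen
  -- representatives.
  have hle : Algebra.adjoin k (S : Set (ExtAlg (gradingC k))) ≤ (vanishing k N).map q :=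
    Algebra.adjoin_le fun s hs => ⟨r s, hN s hs _ (by rw [length_testWord]; omega), hr s⟩
  obtain ⟨f, hf, hne⟩ := exists_cocycle_testWord k N
  obtain ⟨g, hg, h⟩ := hle (hS ▸ Algebra.mem_top (x := q ⟨f, hf⟩))
  have hsub : (⟨f, hf⟩ : cocycles (gradingC k)) - g ∈ coboundaries (gradingC k) :=
    Ideal.Quotient.eq.1 h.symm
  have := add_mem (coboundaries_le_vanishing k (n := N) hsub) hg
  rw [sub_add_cancel] at this
  exact hne this

end NotFinite

end Yoneda

theorem mainTheorem1 (k : Type u) [Field k] :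
    Yoneda.IsTwoDetermined (Yoneda.gradingC k) 4 ∧
      ¬ Algebra.FiniteType k (Yoneda.ExtAlg (Yoneda.gradingC k)) :=
  ⟨Yoneda.isTwoDetermined_gradingC k, Yoneda.not_finiteType_extAlg k⟩
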